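/- Let $\partial=\frac{d}{dz}$, $\vartheta=z\partial$, and let $L=\partial^{n+1}+\sum_{i=0}^{n}a_i\partial^i\in\mathbb{Q}(z)[\partial]$. A power series $\sum_m A_mz^m\in\mathbb{Q}[[z]]$ is called N-integral if there is an integer $N\ge 1$ with $N^mA_m\in\mathbb{Z}$ for all $m\ge 0$. Suppose $L$ has a flag at $z=0$, i.e. solutions $y_k=\sum_{j=0}^{k}\frac{1}{j!}\ln(z)^jf_{k-j}$ $(0\le k\le n)$ with $f_j\in z^r\mathbb{Q}[[z]]$, $f_0\in z^r(1+z\mathbb{Q}[[z]])$ for some $r\in\mathbb{Z}$. Put $\mathcal{N}_0=1$ and $\mathcal{N}_{k+1}=\vartheta\,\frac{1}{\mathcal{N}_k(y_k)}\,\mathcal{N}_k$. The structure series of $L$ are $\alpha_i=\mathcal{N}_i(y_i)^{-1}\in\mathbb{Q}[[z]]$, $1\le i\le n$. For $n\ge 1$ the special coordinate of $L$ is the power series $q\in z\mathbb{Q}[[z]]$ with $\vartheta q=\alpha_1^{-1}q$ and $q'(0)=1$ (so $q=\exp(y_1/y_0)$ up to normalization). With $q^\vee$ its compositional inverse, the $Y$-invariants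 of $L$ are $Y_i=\left(\frac{\alpha_{i+1}}{\alpha_1}\right)^{-1}\circ q^\vee$ for $1\le i\le n-2$. The operator $L$ is of CY-type if $n\geq 1$, $L$ is irreducible in $\mathbb{Q}(z)[\partial]$ and (P) there is $0\neq\alpha\in\mathbb{Q}(z)$ with $L\alpha=\alpha L^\vee$, where $L^\vee=\sum_{i=0}^{n+1}(-1)^{n+1+i}\partial^ia_i$, $a_{n+1}=1$; (M) $z=0$ is a regular singular point of $L$ and all exponents of $L$ there are equal to one integer $r$; (N) $L$ has a nonzero N-integral solution in $\mathbb{Q}[[z]]$; (Q) the special coordinate of $L$ is N-integral; (S) all structure series $\alpha_1,\dots,\alpha_n$ of $L$ are N-integral. For a nonzero algebraic function $g$ (an element of an algebraic closure of $\mathbb{Q}(z)$) let $L\otimes g=gLg^{-1}$, the monic operator whose solutions are the products of $g$ with the solutions of $L$. For a monic operator $P\in\mathbb{Q}(z)[\partial]$ let $\mathrm{Sym}^n(P)$ be the minimal monic operator annihilating $e^n$ in the $n$-th symmetric power of the differential module $\mathbb{Q}(z)[\partial]/\mathbb{Q}(z)[\partial]P$ with cyclic vector $e=[1]$. Proposition.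 Let $L$ be an operator of CY-type of degree $n+1$. There are a nonzero algebraic function $g$ over $\mathbb{Q}(z)$ and an operator $P$ of CY-type of degree two such that $L\otimes g=\mathrm{Sym}^n(P)$ if and only if all $Y$-invariants of $L$ are equal to $1$. -/

import Mathlib

open scoped Differential

noncomputable section

namespace CYOp

/-! ### Derivations

`d/dz` on `ℚ(z)`, on its algebraic closure and on `ℚ((z))` is the unique extension of the usual
derivative of polynomials (of power series) along a localization or a separable algebraic field
extension, both of which are formally étale. -/

/-- The extension of the derivation of `S` to a formally étale `S`-algebra `T`. -/
@[reducible]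
def extendDeriv (S T : Type) [CommRing S] [CommRing T] [Algebra S T] [Differential S]
    [Algebra.FormallyEtale S T] : Differential T :=
  ⟨((LinearMap.liftBaseChange T ((Algebra.linearMap S T) ∘ₗ
      (Differential.deriv : Derivation ℤ S S).liftKaehlerDifferential)) ∘ₗ
    (KaehlerDifferential.tensorKaehlerEquivOfFormallyEtale ℤ S T).symm.toLinearMap).compDer
      (KaehlerDifferential.D ℤ T)⟩

theorem extendDeriv_algebraMap (S T : Type) [CommRing S] [CommRing T] [Algebra S T]
    [Differential S] [Algebra.FormallyEtale S T] :
    let _ := extendDeriv S T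
    DifferentialAlgebra S T := by
  let _ := extendDeriv S T
  refine ⟨fun s => ?_⟩
  change (LinearMap.liftBaseChange T ((Algebra.linearMap S T) ∘ₗ
      (Differential.deriv : Derivation ℤ S S).liftKaehlerDifferential))
    ((KaehlerDifferential.tensorKaehlerEquivOfFormallyEtale ℤ S T).symm
      (KaehlerDifferential.D ℤ T (algebraMap S T s))) = _
  rw [KaehlerDifferential.tensorKaehlerEquivOfFormallyEtale_symm_D_algebraMap]
  simp

/-- The field `ℚ(z)` of rational functions. -/
abbrev RatFun := RatFunc ℚ

/-- The field `ℚ(z)^alg` of algebraic functions. -/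
abbrev AlgFun := AlgebraicClosure RatFun

instance : Algebra.FormallyEtale (Polynomial ℚ) RatFun :=
  Algebra.FormallyEtale.of_isLocalization (nonZeroDivisors (Polynomial ℚ))

instance : Algebra.FormallyEtale RatFun AlgFun :=
  Algebra.FormallyEtale.of_isSeparable RatFun AlgFun

instance : Algebra.FormallyEtale (PowerSeries ℚ) (LaurentSeries ℚ) :=
  Algebra.FormallyEtale.of_isLocalization (nonZeroDivisors (PowerSeries ℚ))

/-- The inclusion of `ℚ(z)` into `ℚ((z))`. -/
instance : Algebra RatFun (LaurentSeries ℚ) := RatFunc.liftAlgebra ℚ (LaurentSeries ℚ)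

/-- An additive map with the product rule, as a derivation. -/
@[reducible]
def differentialOf {R : Type} [CommRing R] (f : R →+ R)
    (h : ∀ a b : R, f (a * b) = a * f b + b * f a) : Differential R :=
  ⟨Derivation.mk' f.toIntLinearMap h⟩

/-- `d/dz` on `ℚ[z]`. -/
instance : Differential (Polynomial ℚ) :=
  differentialOf Polynomial.derivative.toAddMonoidHom
    fun a b => by simp [Polynomial.derivative_mul]; ring

/-- `d/dz` on `ℚ⟦z⟧`. -/
instance : Differential (PowerSeries ℚ) :=
  differentialOf (PowerSeries.derivative ℚ).toLinearMap.toAddMonoidHom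
    fun a b => (PowerSeries.derivative ℚ).leibniz a b

/-- `d/dz` on `ℚ(z)`. -/
instance : Differential RatFun := extendDeriv (Polynomial ℚ) RatFun

instance : DifferentialAlgebra (Polynomial ℚ) RatFun := extendDeriv_algebraMap _ _

/-- `d/dz` on algebraic functions. -/
instance : Differential AlgFun := extendDeriv RatFun AlgFun

instance : DifferentialAlgebra RatFun AlgFun := extendDeriv_algebraMap _ _

/-- `d/dz` on `ℚ((z))`. -/
instance : Differential (LaurentSeries ℚ) := extendDeriv (PowerSeries ℚ) (LaurentSeries ℚ)

instance : DifferentialAlgebra (PowerSeries ℚ) (LaurentSeries ℚ) := extendDeriv_algebraMap _ _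

/-- The coordinate `z` in `ℚ((z))`. -/
def z : LaurentSeries ℚ := algebraMap (PowerSeries ℚ) (LaurentSeries ℚ) PowerSeries.X

/-- The ring `ℚ((z))[log z]`; the polynomial variable is `log z`. -/
abbrev LogSeries := Polynomial (LaurentSeries ℚ)

/-- `d/dz` on `ℚ((z))[log z]`, with `d(log z)/dz = 1/z`. -/
instance : Differential LogSeries := ⟨Differential.implicitDeriv (Polynomial.C z⁻¹)⟩

/-- The Euler operator `ϑ = z d/dz` on `ℚ((z))[log z]`. -/
def theta (y : LogSeries) : LogSeries := Polynomial.C z * y′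

/-! ### Differential operators -/

/-- The monic differential operator `∂^d + ∑_{i<d} a_i ∂^i` over `F`, given by its
coefficients `a_i`. -/
structure MonicOp (F : Type) (d : ℕ) where
  coeff : Fin d → F

/-- The action of an operator on an element `w` of a differential module with derivation `δ`. -/
def MonicOp.act {F : Type} [Field F] {d : ℕ} (L : MonicOp F d) {M : Type} [AddCommGroup M]
    [Module F M] (δ : M → M) (w : M) : M :=
  δ^[d] w + ∑ i : Fin d, L.coeff i • δ^[(i : ℕ)] w

/-- The value `L(y)` of an operator over `ℚ(z)` at `y` in a differential ring containing `ℚ(z)`. -/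
def MonicOp.eval {d : ℕ} (L : MonicOp RatFun d) {A : Type} [CommRing A] [Differential A]
    [Algebra RatFun A] (y : A) : A :=
  L.act (fun x : A => x′) y

/-- Irreducibility in `ℚ(z)[∂]`: in every factorization into two operators (without loss of
generality monic) one of the factors has order zero. Operators over `ℚ(z)` are compared by their
action on `ℚ(z)`, which is faithful. -/
def MonicOp.IsIrreducible {d : ℕ} (L : MonicOp RatFun d) : Prop :=
  0 < d ∧ ∀ (k m : ℕ) (A : MonicOp RatFun k) (B : MonicOp RatFun m),
    (∀ y : RatFun, L.eval y = A.eval (B.eval y)) → k = 0 ∨ m = 0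

/-- The dual operator `L^∨ = ∑_{i ≤ d} (-1)^{d+i} ∂^i a_i` (with `a_d = 1`), as a map on `ℚ(z)`. -/
def MonicOp.dual {d : ℕ} (L : MonicOp RatFun d) (y : RatFun) : RatFun :=
  (fun x : RatFun => x′)^[d] y +
    ∑ i : Fin d, (-1) ^ (d + (i : ℕ)) * (fun x : RatFun => x′)^[(i : ℕ)] (L.coeff i * y)

/-- A power series `∑ A_m z^m` is N-integral if `N^m A_m ∈ ℤ` for all `m`, for some `N ≥ 1`. -/
def NIntegral (y : PowerSeries ℚ) : Prop :=
  ∃ N : ℕ, 0 < N ∧ ∀ m : ℕ, ∃ k : ℤ, (N : ℚ) ^ m * PowerSeries.coeff m y = k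

/-- Zero is a regular singular (or regular) point of `L = ∂^d + ∑ a_i ∂^i`, i.e. all
`z^{d-i} a_i` are holomorphic at zero, and `p` is the indicial polynomial
`∏_{j<d} (T-j) + ∑_i (z^{d-i} a_i)(0) ∏_{j<i} (T-j)`, whose roots are the exponents at zero. -/
def MonicOp.IsIndicialPolynomial {d : ℕ} (L : MonicOp RatFun d) (p : Polynomial ℚ) : Prop :=
  ∃ c : Fin d → PowerSeries ℚ,
    (∀ i : Fin d, z ^ (d - (i : ℕ)) * algebraMap RatFun (LaurentSeries ℚ) (L.coeff i) =
      algebraMap (PowerSeries ℚ) (LaurentSeries ℚ) (c i)) ∧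
    p = descPochhammer ℚ d +
      ∑ i : Fin d, Polynomial.C (PowerSeries.constantCoeff (c i)) * descPochhammer ℚ (i : ℕ)

/-! ### Local data at zero -/

/-- `y_0, …, y_n` is a flag of `L` (of order `n+1`) at zero: solutions
`y_k = ∑_{j ≤ k} (1/j!) log(z)^j f_{k-j}` with `f_j ∈ z^r ℚ⟦z⟧` and `f_0 ∈ z^r (1 + z ℚ⟦z⟧)`.
They have different degrees in `log z`, hence form a basis of the solution space. -/
def MonicOp.IsFlag {n : ℕ} (L : MonicOp RatFun (n + 1)) (y : ℕ → LogSeries) : Prop :=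
  ∃ (r : ℤ) (f : ℕ → PowerSeries ℚ), PowerSeries.constantCoeff (f 0) = 1 ∧
    ∀ k ≤ n, L.eval (y k) = 0 ∧
      y k = ∑ j ∈ Finset.range (k + 1), Polynomial.monomial j
        (z ^ r * algebraMap (PowerSeries ℚ) (LaurentSeries ℚ)
          (PowerSeries.C (1 / (j.factorial : ℚ)) * f (k - j)))

/-- The operators `𝒩_0 = 1`, `𝒩_{k+1} = ϑ a_k 𝒩_k`. -/
def normalOp (a : ℕ → LaurentSeries ℚ) : ℕ → LogSeries → LogSeries
  | 0, x => x
  | k + 1, x => theta (Polynomial.C (a k) * normalOp a k x)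

/-- `α_1, …, α_n` are the structure series of `L`: `α_k = 𝒩_k(y_k)⁻¹` for a flag `y`, where
`𝒩_0 = 1` and `𝒩_{k+1} = ϑ 𝒩_k(y_k)⁻¹ 𝒩_k`. (Values of `α` outside of `1, …, n` play no role.) -/
def MonicOp.IsStructureSeries {n : ℕ} (L : MonicOp RatFun (n + 1)) (α : ℕ → PowerSeries ℚ) : Prop :=
  ∃ (y : ℕ → LogSeries) (a : ℕ → LaurentSeries ℚ), L.IsFlag y ∧
    (∀ k ≤ n, Polynomial.C (a k) * normalOp a k (y k) = 1) ∧
    ∀ k, 1 ≤ k → k ≤ n → a k = algebraMap (PowerSeries ℚ) (LaurentSeries ℚ) (α k)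

/-- `q` is the special coordinate of `L` (of order `n + 1 ≥ 2`):
`ϑ q = α_1⁻¹ q`, `q(0) = 0`, `q'(0) = 1`, that is `q = exp(y_1/y_0)`, normalized. -/
def MonicOp.IsSpecialCoordinate {n : ℕ} (L : MonicOp RatFun (n + 1)) (q : PowerSeries ℚ) : Prop :=
  1 ≤ n ∧ ∃ α : ℕ → PowerSeries ℚ, L.IsStructureSeries α ∧
    PowerSeries.X * q′ = (α 1)⁻¹ * q ∧
    PowerSeries.constantCoeff q = 0 ∧ PowerSeries.coeff 1 q = 1

/-- `Y` is the `i`-th Y-invariant `(α_{i+1}/α_1)⁻¹ ∘ q^∨` of `L`, where `q^∨` is the compositional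
inverse of the special coordinate `q`. -/
def MonicOp.IsYInvariant {n : ℕ} (L : MonicOp RatFun (n + 1)) (i : ℕ) (Y : PowerSeries ℚ) : Prop :=
  ∃ (α : ℕ → PowerSeries ℚ) (q p : PowerSeries ℚ), L.IsStructureSeries α ∧
    L.IsSpecialCoordinate q ∧
    PowerSeries.constantCoeff p = 0 ∧ PowerSeries.subst p q = PowerSeries.X ∧
    Y = PowerSeries.subst p (α (i + 1) * (α 1)⁻¹)⁻¹

/-- Operators of CY-type, of order `n + 1`. -/
structure MonicOp.IsCYType {n : ℕ} (L : MonicOp RatFun (n + 1)) : Prop where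
  irreducible : L.IsIrreducible
  /-- (P): `L α = α L^∨` for some nonzero `α ∈ ℚ(z)`. -/
  propP : ∃ α : RatFun, α ≠ 0 ∧ ∀ y : RatFun, L.eval (α * y) = α * L.dual y
  /-- (M): all exponents at zero are equal to one integer. -/
  propM : ∃ r : ℤ,
    L.IsIndicialPolynomial ((Polynomial.X - Polynomial.C (r : ℚ)) ^ (n + 1))
  /-- (N): there is a nonzero N-integral solution at zero. -/
  propN : ∃ y : PowerSeries ℚ, y ≠ 0 ∧ NIntegral y ∧
    L.eval (algebraMap (PowerSeries ℚ) (LaurentSeries ℚ) y) = 0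
  /-- (Q): the special coordinate is N-integral. -/
  propQ : ∃ q : PowerSeries ℚ, L.IsSpecialCoordinate q ∧ NIntegral q
  /-- (S): the structure series are N-integral. -/
  propS : ∃ α : ℕ → PowerSeries ℚ, L.IsStructureSeries α ∧
    ∀ k, 1 ≤ k → k ≤ n → NIntegral (α k)

/-! ### Tensor products and symmetric powers -/

/-- `S = L ⊗ g` for a nonzero algebraic function `g`: the operator `g L g⁻¹`, whose solutions are
the products of `g` with the solutions of `L`. Operators over `ℚ(z)^alg` are compared by their
action on `ℚ(z)^alg`, which is faithful. -/
def MonicOp.IsTensor {d : ℕ} (L : MonicOp RatFun d) (g : AlgFun) (S : MonicOp RatFun d) : Prop :=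
  ∀ y : AlgFun, S.eval y = g * L.eval (g⁻¹ * y)

/-- In the differential module `M_P = ℚ(z)[∂]/ℚ(z)[∂]P` with basis `e, ∂e, …, ∂^d e`, where `P`
has order `d + 1`: the derivative `∂(∂^j e)`, written as a linear form in variables `X_j = ∂^j e`. -/
def MonicOp.derivBasis {d : ℕ} (P : MonicOp RatFun (d + 1)) (j : Fin (d + 1)) :
    MvPolynomial (Fin (d + 1)) RatFun :=
  if h : (j : ℕ) + 1 < d + 1 then MvPolynomial.X ⟨(j : ℕ) + 1, h⟩
  else -∑ i : Fin (d + 1), MvPolynomial.C (P.coeff i) * MvPolynomial.X i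

/-- The derivation on the symmetric algebra of `M_P` (the polynomial ring in the basis
`X_j = ∂^j e`): it extends `d/dz` on coefficients and `∂` on `M_P` by the product rule. -/
def MonicOp.symDeriv {d : ℕ} (P : MonicOp RatFun (d + 1)) (p : MvPolynomial (Fin (d + 1)) RatFun) :
    MvPolynomial (Fin (d + 1)) RatFun :=
  ∑ m ∈ p.support, MvPolynomial.monomial m (MvPolynomial.coeff m p)′ +
    ∑ j : Fin (d + 1), MvPolynomial.pderiv j p * P.derivBasis j

/-- `S = Sym^n(P)`: the minimal monic operator of `e^n` in the `n`-th symmetric power of the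
marked differential module `(M_P, e)`. -/
def MonicOp.IsSymPower {d m : ℕ} (n : ℕ) (P : MonicOp RatFun (d + 1)) (S : MonicOp RatFun m) : Prop :=
  S.act P.symDeriv (MvPolynomial.X 0 ^ n) = 0 ∧
    ∀ k < m, ∀ T : MonicOp RatFun k, T.act P.symDeriv (MvPolynomial.X 0 ^ n) ≠ 0

end CYOp

end

/-!
Put `𝒩_{k+1} = ϑ a_k ⋯ ϑ a_1 ϑ a_0`. A flag `y_0, …, y_n` determines the sequence `a` by
`a_k 𝒩_k(y_k) = 1`, and then `L` is, up to a left factor in `ℚ((z))`, the operator `𝒩_{n+1}`,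
because both kill the flag (`eq_C_mul_normPoly`). Here `a_0 = 1 / y_0`, and `a_k = α_k` is the
`k`-th structure series for `k ≥ 1`.

The normal form is unique up to constants (`normalForm_unique`). Indeed `α_k(0) ≠ 0`, so
integrating with respect to `α_k⁻¹ dz/z` raises the degree in `log z` by exactly one; hence a
solution of degree `k` in `log z` is killed by `𝒩_{k+1}` already. Since `α_k(0) = 1`, which is read
off from the values of the flag at `z = 0`, the structure series do not depend on the flag. Taking
adjoints reverses the order of the factors. Under (P), uniqueness therefore yields
`α_{n+1-k} = α_k` and determines the multiplier `A` in `L A = A L^∨` up to a constant: `A z^n` is a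
constant multiple of `y_0^2 / (α_1 ⋯ α_n)` (`NormalForm.duality`).

All `Y_i` are equal to `1` if and only if `α_1 = ⋯ = α_{n-1}`, as substitution of a compositional
inverse is injective. By duality `α_n = α_1`, so the condition says that all structure series are
the same series `α`. Equivalently, with `t = y_1 / y_0`, so that `α ϑ t = 1`, the solutions of `L`
are spanned by `y_0, y_0 t, …, y_0 t^n`.

If `L ⊗ g = Sym^n(P)`, let `x_0` and `x_0 t` be the flag of `P`. The solutions of `Sym^n(P)` are
the functions `x_0^n t^k`. Comparing coefficients shows that `g'/g` is rational; it is minus the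
logarithmic derivative of a Laurent series `f`, which is found by following the solution `y_0` of
`L` through the factors of the normal form. So `L` has the solutions `f x_0^n t^k`, and by
uniqueness all of its structure series are equal to that of `P` (`NormalForm.eq_of_isSymPower`).

Conversely, suppose that all structure series are equal to `α`, and put `h = √α`. By duality
`g = (A z^n)^(-1/2)` is a constant multiple of `h^n / y_0`, so the solutions of `L ⊗ g` are spanned
by the functions `h^n t^k`. These are the products of `n` solutions of the operator
`P = ∂^2 + z⁻¹ ∂ + b` with solutions `h` and `h t`; hence `L ⊗ g = Sym^n(P)`. The coefficient of
`∂^(n-1)` in `Sym^n(P)` is a positive multiple of `b` plus a rational function, so `b` is rational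
(`coeff_symPoly`). The operator `P` has the same special coordinate as `L` and the structure series
`α`; its solution `h` is N-integral, by means of the generating function of the Catalan numbers
(`NIntegral.exists_sq_eq`). Finally `P` is irreducible, because a right factor `∂ - v` of `P` gives
the right factor `∂ - n v` of `Sym^n(P)` (`MonicOp.IsIrreducible.of_symPower`).
-/

noncomputable section

namespace CYOp

/-! ### The ring of differential operators -/

section Operators

variable {F M : Type} [Field F] [AddCommGroup M] [Module F M]

/-- The action of the differential operator `∑ p_i ∂^i`, encoded as the polynomial `p`, on a
differential module with derivation `δ`. -/
def opAct (δ : M → M) (p : Polynomial F) (m : M) : M := p.sum fun i c => c • δ^[i] m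

theorem opAct_eq_sum_range (δ : M → M) (p : Polynomial F) (m : M) {d : ℕ}
    (hd : p.natDegree < d) : opAct δ p m = ∑ i ∈ Finset.range d, p.coeff i • δ^[i] m :=
  Polynomial.sum_over_range' p (by simp) d hd

@[simp] theorem opAct_zero_left (δ : M → M) (m : M) : opAct δ (0 : Polynomial F) m = 0 := by
  simp [opAct]

theorem opAct_monomial (δ : M → M) (i : ℕ) (c : F) (m : M) :
    opAct δ (Polynomial.monomial i c) m = c • δ^[i] m := by
  simp [opAct, Polynomial.sum_monomial_index]

theorem opAct_C (δ : M → M) (c : F) (m : M) : opAct δ (Polynomial.C c) m = c • m := by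
  simpa using opAct_monomial δ 0 c m

theorem opAct_one (δ : M → M) (m : M) : opAct δ (1 : Polynomial F) m = m := by
  simpa using opAct_C δ (1 : F) m

theorem opAct_X_pow (δ : M → M) (i : ℕ) (m : M) :
    opAct δ (Polynomial.X ^ i : Polynomial F) m = δ^[i] m := by
  rw [Polynomial.X_pow_eq_monomial, opAct_monomial, one_smul]

theorem opAct_X (δ : M → M) (m : M) :
    opAct δ (Polynomial.X : Polynomial F) m = δ m := by
  simpa using opAct_X_pow (F := F) δ 1 m

theorem opAct_add_left (δ : M → M) (p q : Polynomial F) (m : M) :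
    opAct δ (p + q) m = opAct δ p m + opAct δ q m :=
  Polynomial.sum_add_index p q _ (by simp) (by intros; rw [add_smul])

theorem opAct_C_mul (δ : M → M) (c : F) (p : Polynomial F) (m : M) :
    opAct δ (Polynomial.C c * p) m = c • opAct δ p m := by
  induction p using Polynomial.induction_on' with
  | add p q hp hq => rw [mul_add, opAct_add_left, opAct_add_left, hp, hq, smul_add]
  | monomial i a => rw [Polynomial.C_mul_monomial, opAct_monomial, opAct_monomial, mul_smul]

theorem opAct_sub_left (δ : M → M) (p q : Polynomial F) (m : M) :
    opAct δ (p - q) m = opAct δ p m - opAct δ q m := by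
  have h := opAct_add_left δ p (Polynomial.C (-1) * q) m
  rw [opAct_C_mul] at h
  simpa [sub_eq_add_neg] using h

theorem opAct_sum_left {ι : Type} (δ : M → M) (s : Finset ι) (p : ι → Polynomial F) (m : M) :
    opAct δ (∑ i ∈ s, p i) m = ∑ i ∈ s, opAct δ (p i) m := by
  classical
  induction s using Finset.induction_on with
  | empty => simp
  | insert i s hi ih => rw [Finset.sum_insert hi, Finset.sum_insert hi, opAct_add_left, ih]

theorem opAct_add_right (δ : M →+ M) (p : Polynomial F) (m m' : M) :
    opAct δ p (m + m') = opAct δ p m + opAct δ p m' := by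
  simp [opAct, Polynomial.sum, Finset.sum_add_distrib, smul_add]

theorem opAct_zero_right (δ : M →+ M) (p : Polynomial F) : opAct δ p (0 : M) = 0 := by
  simp [opAct, Polynomial.sum]

/-- The derivation `∂ + u` of a differential module. -/
def shift (δ : M →+ M) (u : F) : M →+ M := δ + DistribSMul.toAddMonoidHom M u

theorem shift_apply (δ : M →+ M) (u : F) (m : M) : shift δ u m = δ m + u • m := rfl

theorem shift_shift (δ : M →+ M) (u v : F) : shift (shift δ u) v = shift δ (u + v) := by
  ext m
  simp only [shift_apply, add_smul, add_assoc]

theorem shift_zero (δ : M →+ M) : shift δ (0 : F) = δ := by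
  ext m
  simp [shift_apply]

/-- The operator `p` has order at most `d` and leading coefficient `c` in order `d`. -/
def HasLead (p : Polynomial F) (d : ℕ) (c : F) : Prop := p.natDegree ≤ d ∧ p.coeff d = c

theorem HasLead.C_mul {p : Polynomial F} {d : ℕ} {c : F} (h : HasLead p d c) (a : F) :
    HasLead (Polynomial.C a * p) d (a * c) :=
  ⟨(Polynomial.natDegree_C_mul_le _ _).trans h.1, by rw [Polynomial.coeff_C_mul, h.2]⟩

theorem HasLead.add {p q : Polynomial F} {d : ℕ} {c e : F} (h : HasLead p d c)
    (h' : HasLead q d e) : HasLead (p + q) d (c + e) :=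
  ⟨Polynomial.natDegree_add_le_of_degree_le h.1 h'.1, by rw [Polynomial.coeff_add, h.2, h'.2]⟩

theorem HasLead.succ {p : Polynomial F} {d : ℕ} {c : F} (h : HasLead p d c) :
    HasLead p (d + 1) 0 :=
  ⟨h.1.trans d.le_succ, Polynomial.coeff_eq_zero_of_natDegree_lt (Nat.lt_succ_iff.2 h.1)⟩

theorem HasLead.natDegree_eq {p : Polynomial F} {d : ℕ} {c : F} (h : HasLead p d c)
    (hc : c ≠ 0) : p.natDegree = d :=
  le_antisymm h.1 (Polynomial.le_natDegree_of_ne_zero (by rwa [h.2]))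

theorem HasLead.ne_zero {p : Polynomial F} {d : ℕ} {c : F} (h : HasLead p d c)
    (hc : c ≠ 0) : p ≠ 0 := by
  rintro rfl
  exact hc (by simpa using h.2.symm)

theorem hasLead_one : HasLead (1 : Polynomial F) 0 1 := ⟨by simp, by simp⟩

theorem hasLead_C (a : F) : HasLead (Polynomial.C a) 0 a := ⟨by simp, by simp⟩

theorem hasLead_X : HasLead (Polynomial.X : Polynomial F) 1 1 := ⟨by simp, by simp⟩

theorem HasLead.natDegree_sub_lt {p q : Polynomial F} {d : ℕ} {c : F} (h : HasLead p (d + 1) c)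
    (h' : HasLead q (d + 1) c) : (p - q).natDegree < d + 1 := by
  rw [Nat.lt_succ_iff, Polynomial.natDegree_le_iff_coeff_eq_zero]
  intro i hi
  rw [Polynomial.coeff_sub]
  rcases (Nat.succ_le_of_lt hi).lt_or_eq with hi' | rfl
  · rw [Polynomial.coeff_eq_zero_of_natDegree_lt (h.1.trans_lt hi'),
      Polynomial.coeff_eq_zero_of_natDegree_lt (h'.1.trans_lt hi'), sub_zero]
  · rw [h.2, h'.2, sub_self]

theorem hasLead_sum {p : ℕ → Polynomial F} {m : ℕ} {e : F} (r : ℕ → F)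
    (hp : ∀ i, HasLead (p i) (m + i) e) (d : ℕ) :
    HasLead (∑ i ∈ Finset.range (d + 1), r i • p i) (m + d) (r d * e) := by
  have h0 : ∀ d, HasLead (∑ i ∈ Finset.range d, r i • p i) (m + d) 0 := by
    intro d
    induction d with
    | zero => exact ⟨by simp, by simp⟩
    | succ d ih =>
      rw [Finset.sum_range_succ, ← add_zero (0 : F), Polynomial.smul_eq_C_mul]
      exact ih.succ.add ((hp d).C_mul _).succ
  rw [Finset.sum_range_succ, ← zero_add (r d * e), Polynomial.smul_eq_C_mul (r d)]
  exact (h0 d).add ((hp d).C_mul _)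

/-- Operators of orders `0, 1, 2, …` form a basis of the operators over a field. -/
theorem exists_eq_sum_of_hasLead {N : ℕ → Polynomial F} {l : ℕ → F} {d : ℕ} (hl : ∀ i < d, l i ≠ 0)
    (hN : ∀ i < d, HasLead (N i) i (l i)) {p : Polynomial F} (hp : p.degree < d) :
    ∃ r : ℕ → F, p = ∑ i ∈ Finset.range d, Polynomial.C (r i) * N i := by
  induction d generalizing p with
  | zero => exact ⟨0, by simpa using hp⟩
  | succ d ih =>
    have hq : (p - Polynomial.C (p.coeff d / l d) * N d).degree < d := by
      rw [Polynomial.degree_lt_iff_coeff_zero] at hp ⊢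
      intro i hi
      rw [Polynomial.coeff_sub, Polynomial.coeff_C_mul]
      rcases hi.lt_or_eq with hi | rfl
      · rw [hp i hi, Polynomial.coeff_eq_zero_of_natDegree_lt ((hN d d.lt_succ_self).1.trans_lt hi),
          mul_zero, sub_zero]
      · rw [(hN d d.lt_succ_self).2, div_mul_cancel₀ _ (hl d d.lt_succ_self), sub_self]
    obtain ⟨r, hr⟩ := ih (fun i hi => hl i (hi.trans d.lt_succ_self))
      (fun i hi => hN i (hi.trans d.lt_succ_self)) hq
    refine ⟨Function.update r d (p.coeff d / l d), ?_⟩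
    rw [Finset.sum_range_succ, Function.update_self, Finset.sum_congr rfl
      (g := fun i => Polynomial.C (r i) * N i), ← hr, sub_add_cancel]
    intro i hi
    rw [Function.update_of_ne (Finset.mem_range.1 hi).ne]

variable [Differential F]

/-- An additive map `δ` on an `F`-vector space with `δ (f m) = f' m + f δ m`: the action of `∂`
on a differential module over `F`. -/
def IsConnection (δ : M →+ M) : Prop := ∀ (f : F) (m : M), δ (f • m) = f′ • m + f • δ m

/-- Left multiplication by `∂` on differential operators encoded as polynomials:
`∂ ∘ ∑ p_i ∂^i = ∑ p_i ∂^(i+1) + ∑ p_i' ∂^i`. -/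
def oreMul : Polynomial F →+ Polynomial F where
  toFun p := Polynomial.X * p + Differential.mapCoeffs p
  map_zero' := by simp
  map_add' p q := by simp only [map_add]; ring

theorem oreMul_apply (p : Polynomial F) :
    oreMul p = Polynomial.X * p + Differential.mapCoeffs p := rfl

theorem coeff_oreMul_zero (p : Polynomial F) : (oreMul p).coeff 0 = (p.coeff 0)′ := by
  simp [oreMul_apply, Differential.coeff_mapCoeffs]

theorem coeff_oreMul_succ (p : Polynomial F) (i : ℕ) :
    (oreMul p).coeff (i + 1) = p.coeff i + (p.coeff (i + 1))′ := by
  simp [oreMul_apply, Differential.coeff_mapCoeffs, Polynomial.coeff_X_mul]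

theorem opAct_oreMul {δ : M →+ M} (hδ : IsConnection (F := F) δ) (p : Polynomial F) (m : M) :
    opAct δ (oreMul p) m = δ (opAct δ p m) := by
  induction p using Polynomial.induction_on' with
  | add p q hp hq => rw [map_add, opAct_add_left, opAct_add_left, hp, hq, map_add]
  | monomial i a =>
    rw [oreMul_apply, Differential.mapCoeffs_monomial, opAct_add_left, Polynomial.X_mul_monomial,
      opAct_monomial, opAct_monomial, opAct_monomial, hδ, Function.iterate_succ_apply', add_comm]

theorem opAct_iterate_oreMul {δ : M →+ M} (hδ : IsConnection (F := F) δ) (i : ℕ)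
    (p : Polynomial F) (m : M) : opAct δ (oreMul^[i] p) m = δ^[i] (opAct δ p m) := by
  induction i with
  | zero => rfl
  | succ i ih => rw [Function.iterate_succ_apply', opAct_oreMul hδ, ih,
      Function.iterate_succ_apply']

/-- `opAct oreMul p q` is the product of the operators `p` and `q`. -/
theorem opAct_opAct_oreMul {δ : M →+ M} (hδ : IsConnection (F := F) δ) (p q : Polynomial F)
    (m : M) : opAct δ (opAct oreMul p q) m = opAct δ p (opAct δ q m) := by
  induction p using Polynomial.induction_on' with
  | add p p' hp hp' => rw [opAct_add_left, opAct_add_left, opAct_add_left, hp, hp']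
  | monomial i a => rw [opAct_monomial, opAct_monomial, Polynomial.smul_eq_C_mul, opAct_C_mul,
      opAct_iterate_oreMul hδ]

theorem IsConnection.shift {δ : M →+ M} (hδ : IsConnection (F := F) δ) (u : F) :
    IsConnection (F := F) (shift δ u) := by
  intro f m
  rw [shift_apply, shift_apply, hδ, smul_add, smul_comm u f]
  abel

/-- The operator obtained from `p` by substituting `∂ + u` for `∂`. -/
def twist (u : F) (p : Polynomial F) : Polynomial F := opAct (shift oreMul u) p 1

theorem opAct_twist {δ : M →+ M} (hδ : IsConnection (F := F) δ) (u : F) (p : Polynomial F)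
    (m : M) : opAct δ (twist u p) m = opAct (shift δ u) p m := by
  have key : ∀ (i : ℕ), opAct δ ((shift oreMul u)^[i] (1 : Polynomial F)) m
      = (shift δ u)^[i] m := by
    intro i
    induction i with
    | zero => exact opAct_one _ _
    | succ i ih =>
      rw [Function.iterate_succ_apply', shift_apply, opAct_add_left, opAct_oreMul hδ,
        Polynomial.smul_eq_C_mul, opAct_C_mul, ih, Function.iterate_succ_apply', shift_apply]
  induction p using Polynomial.induction_on' with
  | add p q hp hq =>
    rw [twist, opAct_add_left, opAct_add_left, opAct_add_left]
    exact congrArg₂ _ hp hq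
  | monomial i a =>
    rw [twist, opAct_monomial, opAct_monomial, Polynomial.smul_eq_C_mul, opAct_C_mul, key]

/-- Conjugation of an operator with a function `g` substitutes `∂ + u` for `∂`, where `u` is the
logarithmic derivative of `g`. -/
theorem opAct_shift_of_smul {δ : M →+ M} (hδ : IsConnection (F := F) δ) {g u : F}
    (hg : g′ = u * g) (p : Polynomial F) (m : M) :
    opAct δ p (g • m) = g • opAct (shift δ u) p m := by
  have key : ∀ i : ℕ, δ^[i] (g • m) = g • (shift δ u)^[i] m := by
    intro i
    induction i with
    | zero => rfl
    | succ i ih =>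
      rw [Function.iterate_succ_apply', ih, hδ, hg, Function.iterate_succ_apply', shift_apply,
        smul_add, smul_smul, mul_comm u g, add_comm]
  induction p using Polynomial.induction_on' with
  | add p q hp hq => rw [opAct_add_left, hp, hq, opAct_add_left, smul_add]
  | monomial i a => rw [opAct_monomial, opAct_monomial, key, smul_comm]

theorem natDegree_oreMul_lt {p : Polynomial F} {d : ℕ} (hp : p.natDegree < d) :
    (oreMul p).natDegree < d + 1 := by
  rw [Nat.lt_succ_iff, Polynomial.natDegree_le_iff_coeff_eq_zero]
  rintro (_ | i) hi
  · omega
  · rw [coeff_oreMul_succ, Polynomial.coeff_eq_zero_of_natDegree_lt (by omega),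
      Polynomial.coeff_eq_zero_of_natDegree_lt (by omega), map_zero, add_zero]

theorem HasLead.oreMul {p : Polynomial F} {d : ℕ} {c : F} (h : HasLead p d c) :
    HasLead (oreMul p) (d + 1) c := by
  refine ⟨Nat.lt_succ_iff.1 (natDegree_oreMul_lt (Nat.lt_succ_iff.2 h.1)), ?_⟩
  rw [coeff_oreMul_succ, h.2, Polynomial.coeff_eq_zero_of_natDegree_lt
    (Nat.lt_succ_iff.2 h.1), map_zero, add_zero]

theorem HasLead.iterate_oreMul {p : Polynomial F} {d : ℕ} {c : F} (h : HasLead p d c) (i : ℕ) :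
    HasLead (CYOp.oreMul^[i] p) (d + i) c := by
  induction i with
  | zero => exact h
  | succ i ih => rw [Function.iterate_succ_apply']; exact ih.oreMul

theorem HasLead.opAct_oreMul {p q : Polynomial F} {d m : ℕ} {c e : F} (hp : HasLead p d c)
    (hq : HasLead q m e) : HasLead (opAct CYOp.oreMul p q) (m + d) (c * e) := by
  rw [opAct_eq_sum_range _ _ _ (Nat.lt_succ_of_le hp.1), ← hp.2]
  exact hasLead_sum _ (fun i => hq.iterate_oreMul i) d

theorem HasLead.twist {p : Polynomial F} {d : ℕ} {c : F} (hp : HasLead p d c) (u : F) :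
    HasLead (twist u p) d c := by
  have hN : ∀ i, HasLead ((shift CYOp.oreMul u)^[i] (1 : Polynomial F)) (0 + i) 1 := by
    intro i
    induction i with
    | zero => exact hasLead_one
    | succ i ih =>
      rw [Function.iterate_succ_apply', shift_apply, ← add_zero (1 : F),
        Polynomial.smul_eq_C_mul]
      exact ih.oreMul.add (ih.C_mul u).succ
  have h := hasLead_sum p.coeff hN d
  rwa [mul_one, zero_add, hp.2, ← opAct_eq_sum_range _ _ _ (Nat.lt_succ_of_le hp.1)] at h

/-- An operator is determined by its action on a field of characteristic zero that contains
an `x` with `x' = 1`: the commutator with `x` is the formal derivative with respect to `∂`. -/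
theorem eq_zero_of_opAct_eq_zero [CharZero F] {x : F} (hx : x′ = 1) {p : Polynomial F}
    (hp : ∀ y : F, opAct (fun y : F => y′) p y = 0) : p = 0 := by
  have key : ∀ (q : Polynomial F) (y : F), opAct (fun y : F => y′) q (x * y) =
      x * opAct (fun y : F => y′) q y + opAct (fun y : F => y′) (Polynomial.derivative q) y := by
    intro q y
    induction q using Polynomial.induction_on' with
    | add p q hp hq => rw [map_add, opAct_add_left, opAct_add_left, opAct_add_left, hp, hq]; ring
    | monomial i a =>
      have : ∀ i : ℕ, (fun y : F => y′)^[i] (x * y) =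
          x * (fun y : F => y′)^[i] y + (i : F) * (fun y : F => y′)^[i - 1] y := by
        intro i
        induction i with
        | zero => simp
        | succ i ih =>
          rw [Function.iterate_succ_apply', ih]
          simp only [map_add, Derivation.leibniz, smul_eq_mul, hx, Derivation.map_natCast]
          rcases i with _ | i
          · simp
          · simp only [Function.iterate_succ_apply', Nat.add_sub_cancel]
            push_cast
            ring
      rw [Polynomial.derivative_monomial, opAct_monomial, opAct_monomial, opAct_monomial, this]
      simp only [smul_eq_mul]
      ring
  induction hd : p.natDegree generalizing p with
  | zero =>
    rw [Polynomial.eq_C_of_natDegree_eq_zero hd] at hp ⊢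
    have := hp 1
    rw [opAct_C, smul_eq_mul, mul_one] at this
    rw [this, map_zero]
  | succ d ih =>
    exfalso
    have h0 : Polynomial.derivative p = 0 := by
      refine ih (fun y => ?_) (by rw [Polynomial.natDegree_derivative, hd]; rfl)
      have := key p y
      rwa [hp, hp, mul_zero, zero_add, eq_comm] at this
    rw [Polynomial.derivative_eq_zero.1 h0] at hd
    omega

end Operators

/-! ### Derivations on rational functions and on Laurent series -/

/-- The inclusion of power series into Laurent series. -/
abbrev ofPS : PowerSeries ℚ →+* LaurentSeries ℚ := algebraMap (PowerSeries ℚ) (LaurentSeries ℚ)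

theorem ofPS_injective : Function.Injective ofPS := HahnSeries.ofPowerSeries_injective

theorem ofPS_ne_zero {s : PowerSeries ℚ} (hs : s ≠ 0) : ofPS s ≠ 0 :=
  (map_ne_zero_iff _ ofPS_injective).2 hs

theorem ne_zero_of_constantCoeff {s : PowerSeries ℚ} (hs : PowerSeries.constantCoeff s ≠ 0) :
    s ≠ 0 := by
  rintro rfl
  exact hs (map_zero _)

theorem coeff_ofPS (s : PowerSeries ℚ) (m : ℕ) : (ofPS s).coeff (m : ℤ) = PowerSeries.coeff m s :=
  LaurentSeries.coeff_coe_powerSeries s m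

theorem z_ne_zero : z ≠ 0 := ofPS_ne_zero PowerSeries.X_ne_zero

theorem z_eq_single : z = HahnSeries.single 1 1 := HahnSeries.ofPowerSeries_X

theorem deriv_powerSeries (s : PowerSeries ℚ) : s′ = PowerSeries.derivative ℚ s := rfl

theorem deriv_z : z′ = 1 := by
  rw [z, DifferentialAlgebra.deriv_algebraMap, deriv_powerSeries, PowerSeries.derivative_X, map_one]

theorem deriv_ofPS (s : PowerSeries ℚ) : (ofPS s)′ = ofPS (PowerSeries.derivative ℚ s) := by
  rw [DifferentialAlgebra.deriv_algebraMap, deriv_powerSeries]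

theorem deriv_ratFun_X : (RatFunc.X : RatFun)′ = 1 := by
  rw [← RatFunc.algebraMap_X, DifferentialAlgebra.deriv_algebraMap]
  change algebraMap _ _ (Polynomial.derivative Polynomial.X) = 1
  rw [Polynomial.derivative_X, map_one]

/-- The inclusion of rational functions into Laurent series. -/
abbrev ofRat : RatFun →+* LaurentSeries ℚ := algebraMap RatFun (LaurentSeries ℚ)

theorem ofRat_X : ofRat RatFunc.X = z := by
  rw [← RatFunc.algebraMap_X, ofRat, ← IsScalarTower.algebraMap_apply]
  simp [z]

theorem deriv_mul {R : Type} [CommRing R] [Differential R] (a b : R) :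
    (a * b)′ = a * b′ + b * a′ := Derivation.leibniz _ a b

theorem deriv_zpow {F : Type} [Field F] [Differential F] (a : F) (k : ℤ) :
    (a ^ k)′ = k * a ^ (k - 1) * a′ := by
  rw [Derivation.leibniz_zpow, zsmul_eq_mul, smul_eq_mul, mul_assoc]

theorem deriv_add {R : Type} [CommRing R] [Differential R] (a b : R) :
    (a + b)′ = a′ + b′ := map_add _ a b

theorem deriv_zero {R : Type} [CommRing R] [Differential R] : (0 : R)′ = 0 := map_zero _

theorem deriv_one {R : Type} [CommRing R] [Differential R] : (1 : R)′ = 0 :=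
  Derivation.map_one_eq_zero _

theorem deriv_div_eq {F : Type} [Field F] [Differential F] {a b : F} (hb : b ≠ 0) :
    (a / b)′ = (a′ * b - a * b′) / b ^ 2 := by
  have h : (a / b * b)′ = a′ := by rw [div_mul_cancel₀ _ hb]
  rw [deriv_mul] at h
  field_simp
  field_simp at h
  linear_combination h

theorem algebraMap_polynomial (p : Polynomial ℚ) :
    algebraMap (Polynomial ℚ) (LaurentSeries ℚ) p = ofPS (p : PowerSeries ℚ) := rfl

instance : DifferentialAlgebra RatFun (LaurentSeries ℚ) := by
  have hpoly : ∀ p : Polynomial ℚ,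
      (ofRat (algebraMap _ _ p))′ = ofRat (algebraMap _ RatFun p)′ := by
    intro p
    rw [DifferentialAlgebra.deriv_algebraMap (A := Polynomial ℚ), ofRat,
      ← IsScalarTower.algebraMap_apply, ← IsScalarTower.algebraMap_apply,
      algebraMap_polynomial, algebraMap_polynomial,
      DifferentialAlgebra.deriv_algebraMap (A := PowerSeries ℚ)]
    congr 1
    exact PowerSeries.derivative_coe p
  refine ⟨fun f => ?_⟩
  obtain ⟨p, q, hq, rfl⟩ := IsFractionRing.div_surjective (A := Polynomial ℚ) f
  have hq' : algebraMap (Polynomial ℚ) RatFun q ≠ 0 :=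
    IsFractionRing.to_map_ne_zero_of_mem_nonZeroDivisors hq
  rw [map_div₀, deriv_div_eq hq', deriv_div_eq ((map_ne_zero ofRat).2 hq'), hpoly, hpoly]
  simp

theorem z_zpow (k : ℤ) : z ^ k = HahnSeries.single k 1 := by
  rw [z_eq_single]
  exact (RatFunc.single_zpow k).symm

theorem coeff_z_zpow_mul_ofPS (k : ℤ) (s : PowerSeries ℚ) (m : ℤ) :
    (z ^ k * ofPS s).coeff m = (ofPS s).coeff (m - k) := by
  rw [z_zpow, ← sub_add_cancel m k, HahnSeries.coeff_single_mul_add]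
  simp

theorem exists_eq_zpow_mul (f : LaurentSeries ℚ) : ∃ (k : ℤ) (s : PowerSeries ℚ),
    f = z ^ k * ofPS s := by
  refine ⟨f.order, f.powerSeriesPart, ?_⟩
  rw [z_zpow]
  exact (LaurentSeries.single_order_mul_powerSeriesPart f).symm

/-- The Euler operator multiplies the coefficient of `z^m` with `m`. -/
theorem coeff_z_mul_deriv (f : LaurentSeries ℚ) (m : ℤ) : (z * f′).coeff m = m * f.coeff m := by
  obtain ⟨k, s, rfl⟩ := exists_eq_zpow_mul f
  have h : z * (z ^ k * ofPS s)′ =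
      (k : LaurentSeries ℚ) * (z ^ k * ofPS s) +
        z ^ k * ofPS (PowerSeries.X * PowerSeries.derivative ℚ s) := by
    rw [deriv_mul, deriv_zpow, deriv_z, deriv_ofPS, map_mul]
    change _ = _ + z ^ k * (z * _)
    rw [mul_one, zpow_sub_one₀ z_ne_zero]
    field_simp [z_ne_zero]
    ring
  have hk : (k : LaurentSeries ℚ) * (z ^ k * ofPS s) = (k : ℚ) • (z ^ k * ofPS s) := by
    rw [← HahnSeries.C_mul_eq_smul]; simp
  rw [h, hk, HahnSeries.coeff_add, HahnSeries.coeff_smul, coeff_z_zpow_mul_ofPS,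
    coeff_z_zpow_mul_ofPS]
  rcases le_or_gt k m with hm | hm
  · obtain ⟨j, hj⟩ := Int.eq_ofNat_of_zero_le (sub_nonneg.2 hm)
    obtain rfl : m = j + k := by omega
    rw [add_sub_cancel_right, coeff_ofPS, coeff_ofPS]
    rcases j with _ | j
    · simp
    · rw [PowerSeries.coeff_succ_X_mul, PowerSeries.coeff_derivative]
      push_cast
      rw [smul_eq_mul]
      ring
  · have h0 : ∀ t : PowerSeries ℚ, (ofPS t).coeff (m - k) = 0 := by
      intro t
      rw [LaurentSeries.coe_algebraMap, HahnSeries.ofPowerSeries_apply,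
        HahnSeries.embDomain_of_notMem_range]
      rintro ⟨x, hx⟩
      simp at hx
      omega
    rw [h0, h0]
    simp

/-- The constant Laurent series. -/
def cst : ℚ →+* LaurentSeries ℚ := ofPS.comp PowerSeries.C

theorem coeff_zero_cst (c : ℚ) : (cst c).coeff 0 = c := by
  have := coeff_ofPS (PowerSeries.C c) 0
  simpa [cst] using this

theorem cst_eq (c : ℚ) : cst c = HahnSeries.C c := by
  simp [cst]

theorem deriv_cst (c : ℚ) : (cst c)′ = 0 := by
  rw [cst, RingHom.comp_apply, deriv_ofPS, PowerSeries.derivative_C, map_zero]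

theorem eq_cst_of_z_mul_deriv_eq_zero {f : LaurentSeries ℚ} (hf : z * f′ = 0) :
    f = cst (f.coeff 0) := by
  ext m
  have := coeff_z_mul_deriv f m
  rw [hf, HahnSeries.coeff_zero, eq_comm, mul_eq_zero] at this
  rw [cst_eq, HahnSeries.C_apply, HahnSeries.coeff_single]
  split_ifs with h
  · rw [h]
  · exact this.resolve_left (by exact_mod_cast h)

/-! ### Logarithmic series -/

theorem deriv_log_C (f : LaurentSeries ℚ) : (Polynomial.C f : LogSeries)′ = Polynomial.C f′ :=
  Differential.implicitDeriv_C ..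

theorem deriv_logSeries (y : LogSeries) :
    y′ = Differential.mapCoeffs y + Polynomial.C z⁻¹ * Polynomial.derivative y := by
  change Differential.implicitDeriv _ y = _
  simp [Differential.implicitDeriv]

theorem coeff_deriv_logSeries (y : LogSeries) (j : ℕ) :
    (y′).coeff j = (y.coeff j)′ + z⁻¹ * ((j + 1 : ℕ) * y.coeff (j + 1)) := by
  rw [deriv_logSeries, Polynomial.coeff_add, Polynomial.coeff_C_mul, Polynomial.coeff_derivative,
    Differential.coeff_mapCoeffs]
  push_cast
  ring

theorem coeff_theta (y : LogSeries) (j : ℕ) :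
    (theta y).coeff j = z * (y.coeff j)′ + (j + 1 : ℕ) * y.coeff (j + 1) := by
  rw [theta, Polynomial.coeff_C_mul, coeff_deriv_logSeries, mul_add,
    mul_inv_cancel_left₀ z_ne_zero]

theorem theta_mul (x y : LogSeries) : theta (x * y) = x * theta y + y * theta x := by
  simp only [theta, deriv_mul]
  ring

theorem theta_zero : theta 0 = 0 := by simp [theta]

theorem theta_one : theta 1 = 0 := by simp [theta]

theorem theta_cst (c : ℚ) : theta (Polynomial.C (cst c)) = 0 := by
  rw [theta, deriv_log_C, deriv_cst, map_zero, mul_zero]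

theorem theta_cst_mul (c : ℚ) (y : LogSeries) :
    theta (Polynomial.C (cst c) * y) = Polynomial.C (cst c) * theta y := by
  rw [theta_mul, theta_cst, mul_zero, add_zero]

/-- The derivation of a differential ring as an additive map. -/
def derivHom (A : Type) [CommRing A] [Differential A] : A →+ A :=
  (Differential.deriv : Derivation ℤ A A).toLinearMap.toAddMonoidHom

theorem derivHom_apply {A : Type} [CommRing A] [Differential A] (y : A) : derivHom A y = y′ := rfl

theorem isConnection_derivHom {F A : Type} [Field F] [Differential F] [CommRing A]
    [Differential A] [Algebra F A] [DifferentialAlgebra F A] :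
    IsConnection (F := F) (derivHom A) := by
  intro f m
  rw [derivHom_apply, derivHom_apply, Algebra.smul_def, Algebra.smul_def, Algebra.smul_def,
    deriv_mul, DifferentialAlgebra.deriv_algebraMap]
  ring

instance : DifferentialAlgebra (LaurentSeries ℚ) LogSeries := ⟨deriv_log_C⟩

/-! ### Monic operators as polynomials -/

section toPoly

variable {F : Type} [Field F] {d : ℕ}

/-- A monic operator as a polynomial in `∂`. -/
def MonicOp.toPoly (L : MonicOp F d) : Polynomial F :=
  Polynomial.X ^ d + ∑ i : Fin d, Polynomial.monomial (i : ℕ) (L.coeff i)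

theorem MonicOp.act_eq (L : MonicOp F d) {M : Type} [AddCommGroup M] [Module F M] (δ : M → M)
    (w : M) : L.act δ w = opAct δ L.toPoly w := by
  rw [MonicOp.toPoly, opAct_add_left, opAct_X_pow, opAct_sum_left, MonicOp.act]
  simp only [opAct_monomial]

theorem MonicOp.coeff_toPoly (L : MonicOp F d) (i : Fin d) : L.toPoly.coeff i = L.coeff i := by
  rw [MonicOp.toPoly, Polynomial.coeff_add, Polynomial.coeff_X_pow, if_neg i.2.ne, zero_add,
    Polynomial.finsetSum_coeff, Finset.sum_eq_single i]
  · simp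
  · intro j _ hj
    rw [Polynomial.coeff_monomial, if_neg (fun h => hj (Fin.ext h))]
  · simp

theorem MonicOp.hasLead_toPoly (L : MonicOp F d) : HasLead L.toPoly d 1 := by
  have h : (∑ i : Fin d, Polynomial.monomial (i : ℕ) (L.coeff i)).degree < d := by
    refine (Polynomial.degree_sum_le _ _).trans_lt ((Finset.sup_lt_iff (by simp)).2 fun i _ => ?_)
    exact (Polynomial.degree_monomial_le _ _).trans_lt (by exact_mod_cast i.2)
  constructor
  · rw [MonicOp.toPoly]
    exact Polynomial.natDegree_add_le_of_degree_le (Polynomial.natDegree_X_pow_le d)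
      (Polynomial.natDegree_le_of_degree_le h.le)
  · rw [MonicOp.toPoly, Polynomial.coeff_add, Polynomial.coeff_X_pow_self,
      Polynomial.coeff_eq_zero_of_degree_lt h, add_zero]

/-- The monic operator of order `d` with the lower coefficients of `p`. -/
def ofPoly (d : ℕ) (p : Polynomial F) : MonicOp F d := ⟨fun i => p.coeff i⟩

theorem toPoly_ofPoly {p : Polynomial F} (hp : HasLead p d 1) : (ofPoly d p).toPoly = p := by
  ext i
  rcases lt_trichotomy i d with hi | rfl | hi
  · exact (ofPoly d p).coeff_toPoly ⟨i, hi⟩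
  · rw [(ofPoly i p).hasLead_toPoly.2, hp.2]
  · rw [Polynomial.coeff_eq_zero_of_natDegree_lt ((ofPoly d p).hasLead_toPoly.1.trans_lt hi),
      Polynomial.coeff_eq_zero_of_natDegree_lt (hp.1.trans_lt hi)]

end toPoly

theorem HasLead.map {F K : Type} [Field F] [Field K] (φ : F →+* K) {p : Polynomial F} {d : ℕ}
    {c : F} (h : HasLead p d c) : HasLead (p.map φ) d (φ c) :=
  ⟨Polynomial.natDegree_map_le.trans h.1, by rw [Polynomial.coeff_map, h.2]⟩

theorem opAct_map {F K M : Type} [Field F] [Field K] [Algebra F K] [AddCommGroup M] [Module F M]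
    [Module K M] [IsScalarTower F K M] (δ : M → M) (p : Polynomial F) (m : M) :
    opAct δ (p.map (algebraMap F K)) m = opAct δ p m := by
  rw [opAct_eq_sum_range δ p m p.natDegree.lt_succ_self,
    opAct_eq_sum_range δ (p.map (algebraMap F K)) m
      (Nat.lt_succ_of_le Polynomial.natDegree_map_le)]
  simp [algebraMap_smul]

theorem MonicOp.eval_eq {d : ℕ} (L : MonicOp RatFun d) {A : Type} [CommRing A] [Differential A]
    [Algebra RatFun A] (y : A) : L.eval y = opAct (fun x : A => x′) L.toPoly y := L.act_eq _ _

/-- A monic operator over `ℚ(z)` as a polynomial over `ℚ((z))`. -/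
def MonicOp.laurent {d : ℕ} (L : MonicOp RatFun d) : Polynomial (LaurentSeries ℚ) :=
  L.toPoly.map ofRat

theorem MonicOp.hasLead_laurent {d : ℕ} (L : MonicOp RatFun d) : HasLead L.laurent d 1 := by
  have h := L.hasLead_toPoly.map ofRat
  rwa [map_one] at h

instance : IsScalarTower RatFun (LaurentSeries ℚ) LogSeries :=
  inferInstanceAs (IsScalarTower RatFun (LaurentSeries ℚ) (Polynomial (LaurentSeries ℚ)))

theorem MonicOp.eval_log {d : ℕ} (L : MonicOp RatFun d) (y : LogSeries) :
    L.eval y = opAct (derivHom LogSeries) L.laurent y := by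
  rw [MonicOp.laurent, opAct_map, MonicOp.eval_eq]
  rfl

theorem opAct_log_C (p : Polynomial (LaurentSeries ℚ)) (f : LaurentSeries ℚ) :
    opAct (derivHom LogSeries) p (Polynomial.C f) =
      Polynomial.C (opAct (derivHom (LaurentSeries ℚ)) p f) := by
  have key : ∀ i : ℕ, (derivHom LogSeries)^[i] (Polynomial.C f) =
      Polynomial.C ((derivHom (LaurentSeries ℚ))^[i] f) := by
    intro i
    induction i with
    | zero => rfl
    | succ i ih =>
      rw [Function.iterate_succ_apply', Function.iterate_succ_apply', ih]
      rw [derivHom_apply, deriv_log_C, derivHom_apply]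
  induction p using Polynomial.induction_on' with
  | add p q hp hq => rw [opAct_add_left, opAct_add_left, hp, hq, map_add]
  | monomial i a =>
    rw [opAct_monomial, opAct_monomial, key, Polynomial.smul_eq_C_mul, smul_eq_mul, map_mul]

/-! ### Normal forms -/

/-- The operator `𝒩_k`, as a polynomial in `∂`. -/
def normPoly (a : ℕ → LaurentSeries ℚ) : ℕ → Polynomial (LaurentSeries ℚ)
  | 0 => 1
  | k + 1 => Polynomial.C z * oreMul (Polynomial.C (a k) * normPoly a k)

theorem opAct_normPoly (a : ℕ → LaurentSeries ℚ) (k : ℕ) (u : LogSeries) :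
    opAct (derivHom LogSeries) (normPoly a k) u = normalOp a k u := by
  induction k with
  | zero => exact opAct_one _ _
  | succ k ih =>
    rw [normPoly, opAct_C_mul, opAct_oreMul isConnection_derivHom, opAct_C_mul, ih, normalOp, theta,
      Polynomial.smul_eq_C_mul, Polynomial.smul_eq_C_mul, derivHom_apply]

theorem hasLead_normPoly (a : ℕ → LaurentSeries ℚ) (k : ℕ) :
    HasLead (normPoly a k) k (∏ i ∈ Finset.range k, (z * a i)) := by
  induction k with
  | zero => rw [Finset.prod_range_zero]; exact hasLead_one
  | succ k ih =>
    have := ((ih.C_mul (a k)).oreMul).C_mul z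
    rwa [← mul_assoc, mul_comm (z * a k), ← Finset.prod_range_succ] at this

theorem normalOp_eq_zero {a : ℕ → LaurentSeries ℚ} {u : LogSeries} {k i : ℕ} (hki : k ≤ i)
    (hk : normalOp a k u = 0) : normalOp a i u = 0 := by
  induction i, hki using Nat.le_induction with
  | base => exact hk
  | succ i _ ih => rw [normalOp, ih, mul_zero, theta_zero]

theorem normalOp_eq_zero_of_lt {a : ℕ → LaurentSeries ℚ} {u : LogSeries} {k i : ℕ} (hki : k < i)
    (hk : Polynomial.C (a k) * normalOp a k u = 1) : normalOp a i u = 0 :=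
  normalOp_eq_zero hki (by rw [normalOp, hk, theta_one])

section Adapted

variable {n : ℕ} {a : ℕ → LaurentSeries ℚ} {y : ℕ → LogSeries}

theorem ne_zero_of_adapted (h : ∀ k ≤ n, Polynomial.C (a k) * normalOp a k (y k) = 1) {k : ℕ}
    (hk : k ≤ n) : a k ≠ 0 := by
  intro h0
  simpa [h0] using h k hk

/-- The `n + 1` independent functions `y_0, …, y_n` are not all killed by a nonzero operator of
order at most `n`. -/
theorem eq_zero_of_opAct_adapted (h : ∀ k ≤ n, Polynomial.C (a k) * normalOp a k (y k) = 1)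
    {p : Polynomial (LaurentSeries ℚ)} (hp : p.natDegree < n + 1)
    (hpy : ∀ k ≤ n, opAct (derivHom LogSeries) p (y k) = 0) : p = 0 := by
  obtain ⟨r, rfl⟩ := exists_eq_sum_of_hasLead (d := n + 1)
    (N := normPoly a) (fun i hi => Finset.prod_ne_zero_iff.2 fun j hj =>
      mul_ne_zero z_ne_zero (ne_zero_of_adapted h (by rw [Finset.mem_range] at hj; omega)))
    (fun i _ => hasLead_normPoly a i)
    (Polynomial.degree_le_natDegree.trans_lt (by exact_mod_cast hp))
  have hr : ∀ k, k ≤ n → r k = 0 := by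
    intro k
    induction k using Nat.strong_induction_on with
    | _ k ih =>
      intro hk
      have := hpy k hk
      rw [opAct_sum_left, Finset.sum_eq_single k] at this
      · rw [opAct_C_mul, opAct_normPoly, smul_eq_zero] at this
        refine this.resolve_right fun h0 => ?_
        simpa [h0] using h k hk
      · intro i _ hik
        rw [opAct_C_mul, opAct_normPoly]
        rcases lt_or_gt_of_ne hik with hik | hik
        · rw [ih i hik (by omega), zero_smul]
        · rw [normalOp_eq_zero_of_lt hik (h k hk), smul_zero]
      · intro hk'
        simp at hk'
        omega
  refine Finset.sum_eq_zero fun i hi => ?_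
  rw [hr i (by rw [Finset.mem_range] at hi; omega), map_zero, zero_mul]

/-- The factorization of a monic operator that is determined by a basis of solutions. -/
theorem eq_C_mul_normPoly (h : ∀ k ≤ n, Polynomial.C (a k) * normalOp a k (y k) = 1)
    {p : Polynomial (LaurentSeries ℚ)} (hp : HasLead p (n + 1) 1)
    (hpy : ∀ k ≤ n, opAct (derivHom LogSeries) p (y k) = 0) :
    p = Polynomial.C (∏ i ∈ Finset.range (n + 1), (z * a i))⁻¹ * normPoly a (n + 1) := by
  rw [← sub_eq_zero]
  have hl := (hasLead_normPoly a (n + 1)).C_mul (∏ i ∈ Finset.range (n + 1), (z * a i))⁻¹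
  rw [inv_mul_cancel₀ (Finset.prod_ne_zero_iff.2 fun j hj => mul_ne_zero z_ne_zero
    (ne_zero_of_adapted h (by rw [Finset.mem_range] at hj; omega)))] at hl
  refine eq_zero_of_opAct_adapted h (hp.natDegree_sub_lt hl) fun k hk => ?_
  rw [opAct_sub_left, hpy k hk, opAct_C_mul, opAct_normPoly,
    normalOp_eq_zero_of_lt (Nat.lt_succ_of_le hk) (h k hk), smul_zero, sub_zero]

end Adapted

/-! ### Degrees in the logarithm -/

/-- A nonzero logarithmic series of degree `d` whose leading coefficient is a constant. -/
def ConstLead (v : LogSeries) (d : ℕ) : Prop := v.natDegree = d ∧ ∃ c : ℚ, c ≠ 0 ∧ v.coeff d = cst c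

theorem coeff_zero_z_mul_deriv (f : LaurentSeries ℚ) : (z * f′).coeff 0 = 0 := by
  rw [coeff_z_mul_deriv]; simp

theorem coeff_zero_natCast_mul_cst (k : ℕ) (c : ℚ) :
    ((k : LaurentSeries ℚ) * cst c).coeff 0 = k * c := by
  rw [← map_natCast cst, ← map_mul, coeff_zero_cst]

theorem natDegree_le_of_coeff_theta {v : LogSeries} {d : ℕ}
    (h : ∀ j, d ≤ j → (theta v).coeff j = 0) : v.natDegree ≤ d := by
  by_contra! hd
  set e := v.natDegree with he
  have h1 := h e hd.le
  rw [coeff_theta, Polynomial.coeff_eq_zero_of_natDegree_lt (show v.natDegree < e + 1 by omega),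
    mul_zero, add_zero] at h1
  have hc := eq_cst_of_z_mul_deriv_eq_zero h1
  have h2 := h (e - 1) (by omega)
  rw [coeff_theta, Nat.sub_add_cancel (by omega), hc] at h2
  have h3 := congrArg (fun f : LaurentSeries ℚ => f.coeff 0) h2
  simp only [HahnSeries.coeff_add, coeff_zero_z_mul_deriv, coeff_zero_natCast_mul_cst, zero_add,
    HahnSeries.coeff_zero] at h3
  have h4 : (v.coeff e).coeff 0 = 0 :=
    (mul_eq_zero.1 h3).resolve_left (by exact_mod_cast (by omega : e ≠ 0))
  rw [h4, map_zero] at hc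
  have : v = 0 := Polynomial.leadingCoeff_eq_zero.1 hc
  rw [this] at he
  simp at he
  omega

theorem exists_eq_cst_of_theta_eq_zero {v : LogSeries} (h : theta v = 0) :
    ∃ c : ℚ, v = Polynomial.C (cst c) := by
  have hd : v.natDegree ≤ 0 := natDegree_le_of_coeff_theta (by simp [h])
  rw [Polynomial.eq_C_of_natDegree_le_zero hd] at h ⊢
  have := congrArg (fun p : LogSeries => p.coeff 0) h
  simp only [coeff_theta, Polynomial.coeff_C_zero, Polynomial.coeff_C_succ, mul_zero, add_zero,
    Polynomial.coeff_zero] at this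
  exact ⟨_, congrArg _ (eq_cst_of_z_mul_deriv_eq_zero this)⟩

/-- Integration with respect to `s⁻¹ dz/z`, where `s` is a power series with `s(0) ≠ 0`, raises the
degree in the logarithm by one, because `s⁻¹ dz/z` has a nonzero residue. -/
theorem ConstLead.of_theta {v : LogSeries} {d : ℕ} {s : PowerSeries ℚ}
    (hs : PowerSeries.constantCoeff s ≠ 0)
    (hw : ConstLead (Polynomial.C (ofPS s) * theta v) d) : ConstLead v (d + 1) := by
  obtain ⟨hd, c, hc, hdc⟩ := hw
  have hs0 : ofPS s ≠ 0 := ofPS_ne_zero (ne_zero_of_constantCoeff hs)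
  have hj : ∀ j, d + 1 ≤ j → (theta v).coeff j = 0 := by
    intro j hj
    have : (Polynomial.C (ofPS s) * theta v).coeff j = 0 :=
      Polynomial.coeff_eq_zero_of_natDegree_lt (by omega)
    rw [Polynomial.coeff_C_mul] at this
    exact (mul_eq_zero.1 this).resolve_left hs0
  have hle := natDegree_le_of_coeff_theta hj
  have h1 := hj (d + 1) le_rfl
  rw [coeff_theta, Polynomial.coeff_eq_zero_of_natDegree_lt (Nat.lt_succ_of_le hle),
    mul_zero, add_zero] at h1
  have hc' := eq_cst_of_z_mul_deriv_eq_zero h1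
  have hne : (v.coeff (d + 1)).coeff 0 ≠ 0 := by
    intro h0
    rw [h0, map_zero] at hc'
    rw [Polynomial.coeff_C_mul, coeff_theta, hc', mul_zero, add_zero] at hdc
    have h2 : z * (v.coeff d)′ = ofPS (PowerSeries.C c * s⁻¹) := by
      apply mul_left_cancel₀ hs0
      rw [hdc, ← map_mul, mul_left_comm, PowerSeries.mul_inv_cancel _ hs, mul_one]
      rfl
    have h3 := coeff_zero_z_mul_deriv (v.coeff d)
    rw [h2] at h3
    have h4 := coeff_ofPS (PowerSeries.C c * s⁻¹) 0
    rw [Nat.cast_zero, h3] at h4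
    simp [hc, hs] at h4
  refine ⟨le_antisymm hle (Polynomial.le_natDegree_of_ne_zero ?_), _, hne, hc'⟩
  intro h0
  rw [h0] at hne
  simp at hne

theorem natDegree_C_mul_logSeries {f : LaurentSeries ℚ} (hf : f ≠ 0) (u : LogSeries) :
    (Polynomial.C f * u).natDegree = u.natDegree :=
  Polynomial.natDegree_C_mul hf

/-- A solution of `𝒩_{n+1} u = 0` of degree `k` in the logarithm already satisfies
`𝒩_{k+1} u = 0`. -/
theorem exists_normalOp_eq_cst {n : ℕ} {a : ℕ → LaurentSeries ℚ} (h0 : a 0 ≠ 0)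
    (ha : ∀ k, 1 ≤ k → k ≤ n → ∃ s, PowerSeries.constantCoeff s ≠ 0 ∧ a k = ofPS s)
    {u : LogSeries} (hu : u ≠ 0) (hnu : normalOp a (n + 1) u = 0) :
    ∃ c : ℚ, c ≠ 0 ∧
      Polynomial.C (a u.natDegree) * normalOp a u.natDegree u = Polynomial.C (cst c) := by
  set V : ℕ → LogSeries := fun k => Polynomial.C (a k) * normalOp a k u with hV
  have hVs : ∀ k, V (k + 1) = Polynomial.C (a (k + 1)) * theta (V k) := fun k => rfl
  have hV0 : V 0 ≠ 0 := mul_ne_zero (Polynomial.C_ne_zero.2 h0) hu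
  -- Some `V m` is a nonzero constant; from there down to `V 0` each step raises the degree by one.
  obtain ⟨m, hmn, hm, hm'⟩ : ∃ m ≤ n, V m ≠ 0 ∧ theta (V m) = 0 := by
    by_contra! hcon
    have : ∀ m ≤ n, V m ≠ 0 := by
      intro m
      induction m with
      | zero => exact fun _ => hV0
      | succ m ih =>
        intro hm
        obtain ⟨s, hs, has⟩ := ha (m + 1) (by omega) hm
        rw [hVs, has]
        exact mul_ne_zero (Polynomial.C_ne_zero.2 (ofPS_ne_zero (ne_zero_of_constantCoeff hs)))
          (hcon m (by omega) (ih (by omega)))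
    exact hcon n le_rfl (this n le_rfl) hnu
  obtain ⟨c, hc⟩ := exists_eq_cst_of_theta_eq_zero hm'
  have hc0 : c ≠ 0 := by
    rintro rfl
    rw [map_zero, map_zero] at hc
    exact hm hc
  have hdeg : ∀ j ≤ m, ConstLead (V (m - j)) j := by
    intro j
    induction j with
    | zero =>
      intro _
      rw [Nat.sub_zero, hc]
      exact ⟨Polynomial.natDegree_C _, c, hc0, Polynomial.coeff_C_zero⟩
    | succ j ih =>
      intro hj
      obtain ⟨s, hs, has⟩ := ha (m - (j + 1) + 1) (by omega) (by omega)
      refine ConstLead.of_theta hs ?_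
      rw [← has, ← hVs, show m - (j + 1) + 1 = m - j by omega]
      exact ih (by omega)
  have hum : u.natDegree = m := by
    rw [← (hdeg m le_rfl).1, Nat.sub_self]
    exact (natDegree_C_mul_logSeries h0 u).symm
  rw [hum]
  exact ⟨c, hc0, hc⟩

/-- Uniqueness of normal forms up to constant factors. -/
theorem normalForm_unique {n : ℕ} {a b : ℕ → LaurentSeries ℚ} {y : ℕ → LogSeries}
    (hdeg : ∀ k ≤ n, (y k).natDegree = k)
    (h : ∀ k ≤ n, Polynomial.C (a k) * normalOp a k (y k) = 1) (hb0 : b 0 ≠ 0)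
    (hb : ∀ k, 1 ≤ k → k ≤ n → ∃ s, PowerSeries.constantCoeff s ≠ 0 ∧ b k = ofPS s)
    (hbn : ∀ k ≤ n, normalOp b (n + 1) (y k) = 0) :
    ∀ k ≤ n, ∃ c : ℚ, c ≠ 0 ∧ b k = cst c * a k := by
  intro k
  induction k using Nat.strong_induction_on with
  | _ k ih =>
    intro hk
    -- Up to step `k` the two sequences agree up to constants, hence so do the operators.
    have hprop : ∀ i ≤ k, ∃ c : ℚ, c ≠ 0 ∧
        normalOp b i (y k) = Polynomial.C (cst c) * normalOp a i (y k) := by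
      intro i
      induction i with
      | zero => exact fun _ => ⟨1, one_ne_zero, by simp [normalOp]⟩
      | succ i ihi =>
        intro hi
        obtain ⟨c, hc, hci⟩ := ihi (by omega)
        obtain ⟨e, he, hei⟩ := ih i (by omega) (by omega)
        refine ⟨e * c, mul_ne_zero he hc, ?_⟩
        change theta _ = _ * theta _
        have : Polynomial.C (b i) * normalOp b i (y k) =
            Polynomial.C (cst (e * c)) * (Polynomial.C (a i) * normalOp a i (y k)) := by
          rw [hci, hei, Polynomial.C_mul, RingHom.map_mul cst, Polynomial.C_mul,
            mul_mul_mul_comm]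
        rw [this, theta_cst_mul]
    obtain ⟨c, hc, hck⟩ := hprop k le_rfl
    have hy0 : y k ≠ 0 := by
      intro h0
      have := h k hk
      rw [h0, ← opAct_normPoly, opAct_zero_right, mul_zero] at this
      exact zero_ne_one this
    obtain ⟨e, he, hek⟩ := exists_normalOp_eq_cst hb0 hb hy0 (hbn k hk)
    rw [hdeg k hk, hck] at hek
    have h1 := h k hk
    have hcc : cst c ≠ 0 := (map_ne_zero cst).2 hc
    refine ⟨e / c, div_ne_zero he hc, ?_⟩
    have h2 : Polynomial.C (b k) * Polynomial.C (cst c) =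
        Polynomial.C (cst e) * Polynomial.C (a k) := by
      calc Polynomial.C (b k) * Polynomial.C (cst c)
          = (Polynomial.C (b k) * Polynomial.C (cst c)) *
              (Polynomial.C (a k) * normalOp a k (y k)) := by rw [h1, mul_one]
        _ = (Polynomial.C (b k) * (Polynomial.C (cst c) * normalOp a k (y k))) *
              Polynomial.C (a k) := by
            rw [mul_comm (Polynomial.C (a k)), mul_assoc, mul_assoc, mul_assoc]
        _ = _ := by rw [hek]
    rw [← map_mul, ← map_mul] at h2
    have h3 := Polynomial.C_injective h2
    rw [map_div₀, div_mul_eq_mul_div, eq_div_iff hcc, h3]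

/-! ### Flags and structure series -/

/-- The logarithmic series `x` has power series coefficients; evaluating these at `z = 0` gives
`p`. -/
def HasValue (x : LogSeries) (p : Polynomial ℚ) : Prop :=
  ∃ U : Polynomial (PowerSeries ℚ), x = U.map ofPS ∧ p = U.map PowerSeries.constantCoeff

theorem HasValue.theta {x : LogSeries} {p : Polynomial ℚ} (h : HasValue x p) :
    HasValue (theta x) (Polynomial.derivative p) := by
  obtain ⟨U, rfl, rfl⟩ := h
  refine ⟨Polynomial.C PowerSeries.X * Differential.mapCoeffs U + Polynomial.derivative U, ?_, ?_⟩
  · ext1 j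
    rw [coeff_theta]
    simp only [Polynomial.coeff_map, Polynomial.coeff_add, Polynomial.coeff_C_mul,
      Differential.coeff_mapCoeffs, Polynomial.coeff_derivative, map_add, map_mul, deriv_ofPS,
      deriv_powerSeries]
    rw [← z]
    simp only [map_natCast, map_one]
    push_cast
    ring
  · simp [Polynomial.derivative_map]

theorem HasValue.C_mul {x : LogSeries} {p : Polynomial ℚ} (h : HasValue x p)
    (s : PowerSeries ℚ) : HasValue (Polynomial.C (ofPS s) * x)
      (Polynomial.C (PowerSeries.constantCoeff s) * p) := by
  obtain ⟨U, rfl, rfl⟩ := h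
  exact ⟨Polynomial.C s * U, by simp, by simp⟩

theorem HasValue.unique {x : LogSeries} {p q : Polynomial ℚ} (h : HasValue x p)
    (h' : HasValue x q) : p = q := by
  obtain ⟨U, rfl, rfl⟩ := h
  obtain ⟨V, hV, rfl⟩ := h'
  rw [Polynomial.map_injective _ ofPS_injective hV]

theorem hasValue_one : HasValue 1 1 := ⟨1, by simp, by simp⟩

/-- `y_0, …, y_n` is a flag with exponent `r` and power series `f_0, …, f_n`. -/
def IsFlagOf (n : ℕ) (y : ℕ → LogSeries) (r : ℤ) (f : ℕ → PowerSeries ℚ) : Prop :=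
  PowerSeries.constantCoeff (f 0) = 1 ∧ ∀ k ≤ n,
    y k = ∑ j ∈ Finset.range (k + 1), Polynomial.monomial j
        (z ^ r * ofPS (PowerSeries.C (1 / (j.factorial : ℚ)) * f (k - j)))

theorem IsFlagOf.zero {n : ℕ} {y : ℕ → LogSeries} {r : ℤ} {f : ℕ → PowerSeries ℚ}
    (h : IsFlagOf n y r f) : y 0 = Polynomial.C (z ^ r * ofPS (f 0)) := by
  rw [h.2 0 (Nat.zero_le n)]
  simp

theorem IsFlagOf.coeff_self {n : ℕ} {y : ℕ → LogSeries} {r : ℤ} {f : ℕ → PowerSeries ℚ}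
    (h : IsFlagOf n y r f) {k : ℕ} (hk : k ≤ n) : (y k).coeff k =
      z ^ r * ofPS (PowerSeries.C (1 / (k.factorial : ℚ)) * f 0) := by
  rw [h.2 k hk, Polynomial.finsetSum_coeff, Finset.sum_eq_single k]
  · rw [Polynomial.coeff_monomial_same, Nat.sub_self]
  · intro j _ hj
    rw [Polynomial.coeff_monomial_of_ne _ hj.symm]
  · simp

theorem IsFlagOf.natDegree {n : ℕ} {y : ℕ → LogSeries} {r : ℤ} {f : ℕ → PowerSeries ℚ}
    (h : IsFlagOf n y r f) {k : ℕ} (hk : k ≤ n) : (y k).natDegree = k := by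
  refine le_antisymm ?_ (Polynomial.le_natDegree_of_ne_zero ?_)
  · rw [h.2 k hk]
    refine Polynomial.natDegree_sum_le_of_forall_le _ _ fun j hj => ?_
    exact (Polynomial.natDegree_monomial_le _).trans (by rw [Finset.mem_range] at hj; omega)
  · rw [h.coeff_self hk]
    refine mul_ne_zero (zpow_ne_zero _ z_ne_zero) (ofPS_ne_zero (ne_zero_of_constantCoeff ?_))
    rw [map_mul, h.1, PowerSeries.constantCoeff_C]
    have := Nat.factorial_ne_zero k
    positivity

theorem iterate_derivative_monomial_inv_factorial_add {k : ℕ} {q : Polynomial ℚ}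
    (hq : q.degree < k) : Polynomial.derivative^[k]
      (q + Polynomial.monomial k (1 / (k.factorial : ℚ))) = 1 := by
  rw [iterate_map_add, Polynomial.iterate_derivative_eq_zero_of_degree_lt hq,
    zero_add, ← Polynomial.C_mul_X_pow_eq_monomial, Polynomial.iterate_derivative_C_mul,
    Polynomial.iterate_derivative_X_pow_eq_natCast_mul, Nat.sub_self, pow_zero,
    Nat.descFactorial_self, mul_one, ← Polynomial.C_eq_natCast, ← Polynomial.C_mul,
    one_div_mul_cancel (by exact_mod_cast Nat.factorial_ne_zero k), Polynomial.C_1]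

/-- Evaluation at `z = 0` turns `ϑ` into the derivative with respect to the logarithm, and `y_k`
into a polynomial with leading term `ℓ^k / k!`; thus the structure series have constant term
one. -/
theorem constantCoeff_of_adapted {n : ℕ} {y : ℕ → LogSeries} {r : ℤ} {f : ℕ → PowerSeries ℚ}
    (hf : IsFlagOf n y r f) {a : ℕ → LaurentSeries ℚ} {α : ℕ → PowerSeries ℚ}
    (h : ∀ k ≤ n, Polynomial.C (a k) * normalOp a k (y k) = 1)
    (hα : ∀ k, 1 ≤ k → k ≤ n → a k = ofPS (α k)) :
    ∀ k, 1 ≤ k → k ≤ n → PowerSeries.constantCoeff (α k) = 1 := by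
  have hf0 : PowerSeries.constantCoeff (f 0) ≠ 0 := by rw [hf.1]; exact one_ne_zero
  have ha0 : a 0 * (z ^ r * ofPS (f 0)) = 1 := by
    have := h 0 (Nat.zero_le n)
    rw [normalOp, hf.zero, ← map_mul, ← map_one Polynomial.C] at this
    exact Polynomial.C_injective this
  have ha0' : a 0 * z ^ r = ofPS (f 0)⁻¹ := by
    apply mul_right_cancel₀ (ofPS_ne_zero (ne_zero_of_constantCoeff hf0))
    rw [mul_assoc, ha0, ← map_mul, PowerSeries.inv_mul_cancel _ hf0, map_one]
  have hstart : ∀ k ≤ n, ∃ p : Polynomial ℚ, HasValue (Polynomial.C (a 0) * y k) p ∧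
      Polynomial.derivative^[k] p = 1 := by
    intro k hk
    refine ⟨_, ⟨∑ j ∈ Finset.range (k + 1), Polynomial.monomial j
      ((f 0)⁻¹ * (PowerSeries.C (1 / (j.factorial : ℚ)) * f (k - j))), ?_, rfl⟩, ?_⟩
    · rw [hf.2 k hk, Finset.mul_sum, Polynomial.map_sum]
      refine Finset.sum_congr rfl fun j _ => ?_
      rw [Polynomial.C_mul_monomial, Polynomial.map_monomial, ← mul_assoc, ha0', ← map_mul ofPS]
    · rw [Finset.sum_range_succ, Polynomial.map_add, Polynomial.map_monomial, Nat.sub_self]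
      simp only [map_mul, PowerSeries.constantCoeff_inv, hf.1, PowerSeries.constantCoeff_C,
        inv_one, mul_one, one_mul]
      refine iterate_derivative_monomial_inv_factorial_add ?_
      rw [Polynomial.map_sum]
      refine (Polynomial.degree_sum_le _ _).trans_lt
        ((Finset.sup_lt_iff (by exact WithBot.bot_lt_coe k)).2 fun i hi => ?_)
      rw [Polynomial.map_monomial]
      exact (Polynomial.degree_monomial_le _ _).trans_lt
        (by exact_mod_cast Finset.mem_range.1 hi)
  intro k
  induction k using Nat.strong_induction_on with
  | _ k ih =>
    intro hk1 hkn
    obtain ⟨p, hp, hpk⟩ := hstart k hkn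
    have hval : ∀ i < k, HasValue (normalOp a (i + 1) (y k)) (Polynomial.derivative^[i + 1] p) := by
      intro i
      induction i with
      | zero => exact fun _ => hp.theta
      | succ i ihi =>
        intro hi
        have := ((ihi (by omega)).C_mul (α (i + 1))).theta
        rw [ih (i + 1) hi (by omega) (by omega), Polynomial.C_1, one_mul,
          ← hα (i + 1) (by omega) (by omega)] at this
        rw [Function.iterate_succ_apply']
        exact this
    have h1 := (hval (k - 1) (by omega)).C_mul (α k)
    rw [Nat.sub_add_cancel hk1, hpk, ← hα k hk1 hkn, h k hkn, mul_one] at h1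
    exact Polynomial.C_injective ((h1.unique hasValue_one).trans (map_one _).symm)

theorem eq_of_ofPS_eq_cst_mul {s t : PowerSeries ℚ} (hs : PowerSeries.constantCoeff s = 1)
    (ht : PowerSeries.constantCoeff t = 1) {c : ℚ} (h : ofPS s = cst c * ofPS t) : s = t := by
  rw [cst, RingHom.comp_apply, ← map_mul] at h
  have h1 := ofPS_injective h
  have h2 := congrArg PowerSeries.constantCoeff h1
  rw [map_mul, PowerSeries.constantCoeff_C, hs, ht, mul_one] at h2
  rw [h1, ← h2, map_one, one_mul]

/-- A flag of `L`, together with the normal form that it determines. -/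
structure NormalForm {n : ℕ} (L : MonicOp RatFun (n + 1)) (y : ℕ → LogSeries)
    (a : ℕ → LaurentSeries ℚ) (α : ℕ → PowerSeries ℚ) : Prop where
  exists_flag : ∃ r f, IsFlagOf n y r f
  sol : ∀ k ≤ n, opAct (derivHom LogSeries) L.laurent (y k) = 0
  adapted : ∀ k ≤ n, Polynomial.C (a k) * normalOp a k (y k) = 1
  eq_ofPS : ∀ k, 1 ≤ k → k ≤ n → a k = ofPS (α k)

theorem MonicOp.isStructureSeries_iff {n : ℕ} {L : MonicOp RatFun (n + 1)}
    {α : ℕ → PowerSeries ℚ} : L.IsStructureSeries α ↔ ∃ y a, NormalForm L y a α := by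
  constructor
  · rintro ⟨y, a, ⟨r, f, hf0, hf⟩, ha, hα⟩
    exact ⟨y, a, ⟨r, f, hf0, fun k hk => (hf k hk).2⟩,
      fun k hk => (L.eval_log _).symm.trans (hf k hk).1, ha, hα⟩
  · rintro ⟨y, a, ⟨r, f, hf⟩, hs, ha, hα⟩
    exact ⟨y, a, ⟨r, f, hf.1, fun k hk => ⟨(L.eval_log _).trans (hs k hk), hf.2 k hk⟩⟩, ha, hα⟩

namespace NormalForm

variable {n : ℕ} {L : MonicOp RatFun (n + 1)} {y : ℕ → LogSeries}
    {a : ℕ → LaurentSeries ℚ} {α : ℕ → PowerSeries ℚ}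

theorem constantCoeff (h : NormalForm L y a α) :
    ∀ k, 1 ≤ k → k ≤ n → PowerSeries.constantCoeff (α k) = 1 := by
  obtain ⟨r, f, hf⟩ := h.exists_flag
  exact constantCoeff_of_adapted hf h.adapted h.eq_ofPS

theorem natDegree (h : NormalForm L y a α) : ∀ k ≤ n, (y k).natDegree = k := by
  obtain ⟨r, f, hf⟩ := h.exists_flag
  exact fun k hk => hf.natDegree hk

theorem ne_zero (h : NormalForm L y a α) : ∀ k ≤ n, a k ≠ 0 :=
  fun _ hk => ne_zero_of_adapted h.adapted hk

theorem prod_ne_zero (h : NormalForm L y a α) : ∏ i ∈ Finset.range (n + 1), (z * a i) ≠ 0 :=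
  Finset.prod_ne_zero_iff.2 fun j hj => mul_ne_zero z_ne_zero
    (h.ne_zero j (by rw [Finset.mem_range] at hj; omega))

theorem laurent_eq (h : NormalForm L y a α) : L.laurent =
    Polynomial.C (∏ i ∈ Finset.range (n + 1), (z * a i))⁻¹ * normPoly a (n + 1) :=
  eq_C_mul_normPoly h.adapted L.hasLead_laurent h.sol

theorem opAct_eq_zero_iff (h : NormalForm L y a α) (u : LogSeries) :
    opAct (derivHom LogSeries) L.laurent u = 0 ↔ normalOp a (n + 1) u = 0 := by
  rw [h.laurent_eq, opAct_C_mul, opAct_normPoly, smul_eq_zero,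
    or_iff_right (inv_ne_zero h.prod_ne_zero)]

/-- Any factorization with the shape of a normal form that kills the flag has the same structure
series, and its rightmost factor agrees up to a constant. -/
theorem unique (h : NormalForm L y a α) {b : ℕ → LaurentSeries ℚ} {β : ℕ → PowerSeries ℚ}
    (hb0 : b 0 ≠ 0) (hb : ∀ k, 1 ≤ k → k ≤ n → b k = ofPS (β k))
    (hβ : ∀ k, 1 ≤ k → k ≤ n → PowerSeries.constantCoeff (β k) = 1)
    (hbn : ∀ k ≤ n, normalOp b (n + 1) (y k) = 0) :
    (∃ c : ℚ, c ≠ 0 ∧ b 0 = cst c * a 0) ∧ ∀ k, 1 ≤ k → k ≤ n → β k = α k := by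
  have key := normalForm_unique h.natDegree h.adapted hb0
    (fun k hk hkn => ⟨β k, by rw [hβ k hk hkn]; exact one_ne_zero, hb k hk hkn⟩) hbn
  refine ⟨key 0 (Nat.zero_le n), fun k hk hkn => ?_⟩
  obtain ⟨c, -, hck⟩ := key k hkn
  rw [hb k hk hkn, h.eq_ofPS k hk hkn] at hck
  exact eq_of_ofPS_eq_cst_mul (hβ k hk hkn) (h.constantCoeff k hk hkn) hck

end NormalForm

theorem MonicOp.IsStructureSeries.unique {n : ℕ} {L : MonicOp RatFun (n + 1)}
    {α β : ℕ → PowerSeries ℚ} (hα : L.IsStructureSeries α) (hβ : L.IsStructureSeries β) :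
    ∀ k, 1 ≤ k → k ≤ n → β k = α k := by
  obtain ⟨y, a, h⟩ := MonicOp.isStructureSeries_iff.1 hα
  obtain ⟨y', b, h'⟩ := MonicOp.isStructureSeries_iff.1 hβ
  exact (h.unique (h'.ne_zero 0 (Nat.zero_le n)) h'.eq_ofPS h'.constantCoeff
    fun k hk => (h'.opAct_eq_zero_iff _).1 (h.sol k hk)).2

/-! ### Adjoint operators -/

section Adjoint

variable {F M : Type} [Field F] [AddCommGroup M] [Module F M]

/-- The action of the formal adjoint `∑ (-1)^i ∂^i p_i` of an operator `∑ p_i ∂^i`. -/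
def adjAct (δ : M →+ M) (p : Polynomial F) (m : M) : M :=
  p.sum fun i c => (-1 : ℤ) ^ i • δ^[i] (c • m)

theorem adjAct_monomial (δ : M →+ M) (i : ℕ) (c : F) (m : M) :
    adjAct δ (Polynomial.monomial i c) m = (-1 : ℤ) ^ i • δ^[i] (c • m) := by
  simp [adjAct, Polynomial.sum_monomial_index]

theorem adjAct_add_left (δ : M →+ M) (p q : Polynomial F) (m : M) :
    adjAct δ (p + q) m = adjAct δ p m + adjAct δ q m :=
  Polynomial.sum_add_index p q _ (by simp) (by
    intros
    rw [add_smul, iterate_map_add, smul_add])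

theorem adjAct_one (δ : M →+ M) (m : M) : adjAct δ (1 : Polynomial F) m = m := by
  have := adjAct_monomial δ 0 (1 : F) m
  simpa using this

theorem adjAct_C_mul (δ : M →+ M) (c : F) (p : Polynomial F) (m : M) :
    adjAct δ (Polynomial.C c * p) m = adjAct δ p (c • m) := by
  induction p using Polynomial.induction_on' with
  | add p q hp hq => rw [mul_add, adjAct_add_left, adjAct_add_left, hp, hq]
  | monomial i a => rw [Polynomial.C_mul_monomial, adjAct_monomial, adjAct_monomial, mul_smul,
      smul_comm c a]

theorem adjAct_sum_left {ι : Type} (δ : M →+ M) (s : Finset ι) (p : ι → Polynomial F) (m : M) :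
    adjAct δ (∑ i ∈ s, p i) m = ∑ i ∈ s, adjAct δ (p i) m := by
  classical
  induction s using Finset.induction_on with
  | empty => simp [adjAct]
  | insert i s hi ih => rw [Finset.sum_insert hi, Finset.sum_insert hi, adjAct_add_left, ih]

theorem adjAct_map {K : Type} [Field K] [Algebra F K] [Module K M] [IsScalarTower F K M]
    (δ : M →+ M) (p : Polynomial F) (m : M) :
    adjAct δ (p.map (algebraMap F K)) m = adjAct δ p m := by
  induction p using Polynomial.induction_on' with
  | add p q hp hq => rw [Polynomial.map_add, adjAct_add_left, adjAct_add_left, hp, hq]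
  | monomial i a => rw [Polynomial.map_monomial, adjAct_monomial, adjAct_monomial,
      algebraMap_smul]

variable [Differential F]

theorem adjAct_oreMul {δ : M →+ M} (hδ : IsConnection (F := F) δ) (p : Polynomial F) (m : M) :
    adjAct δ (oreMul p) m = -adjAct δ p (δ m) := by
  induction p using Polynomial.induction_on' with
  | add p q hp hq => rw [map_add, adjAct_add_left, adjAct_add_left, hp, hq, neg_add]
  | monomial i a =>
    rw [oreMul_apply, Differential.mapCoeffs_monomial, adjAct_add_left, Polynomial.X_mul_monomial,
      adjAct_monomial, adjAct_monomial, adjAct_monomial, Function.iterate_succ_apply, hδ,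
      iterate_map_add, pow_succ]
    simp

theorem opAct_adjAct_one {δ : M →+ M} (hδ : IsConnection (F := F) δ) (p : Polynomial F) (m : M) :
    opAct δ (adjAct oreMul p (1 : Polynomial F)) m = adjAct δ p m := by
  induction p using Polynomial.induction_on' with
  | add p q hp hq => rw [adjAct_add_left, opAct_add_left, adjAct_add_left, hp, hq]
  | monomial i a =>
    rw [adjAct_monomial, adjAct_monomial]
    have h : (-1 : ℤ) ^ i • oreMul^[i] (a • (1 : Polynomial F)) =
        Polynomial.C ((-1) ^ i) * oreMul^[i] (Polynomial.C a) := by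
      rw [Polynomial.smul_eq_C_mul, mul_one, zsmul_eq_mul]
      simp
    rw [h, opAct_C_mul, opAct_iterate_oreMul hδ, opAct_C]
    rcases neg_one_pow_eq_or F i with h | h <;> rcases Nat.even_or_odd i with h' | h' <;>
      simp [h'.neg_one_pow]

end Adjoint

theorem algebraMap_ratFun_logSeries (f : RatFun) :
    algebraMap RatFun LogSeries f = Polynomial.C (ofRat f) := rfl

instance : DifferentialAlgebra RatFun LogSeries := ⟨fun f => by
  rw [algebraMap_ratFun_logSeries, deriv_log_C, DifferentialAlgebra.deriv_algebraMap]
  rfl⟩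

theorem MonicOp.dual_eq {d : ℕ} (L : MonicOp RatFun d) (y : RatFun) :
    L.dual y = (-1) ^ d * adjAct (derivHom RatFun) L.toPoly y := by
  rw [MonicOp.dual, MonicOp.toPoly, Polynomial.X_pow_eq_monomial, adjAct_add_left, adjAct_sum_left,
    adjAct_monomial, mul_add, Finset.mul_sum, one_smul]
  congr 1
  · rw [zsmul_eq_mul, ← mul_assoc]
    push_cast
    rw [← mul_pow]
    simp
    rfl
  · refine Finset.sum_congr rfl fun i _ => ?_
    rw [adjAct_monomial, zsmul_eq_mul, ← mul_assoc]
    push_cast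
    rw [← pow_add]
    rfl

/-- Property (P), transported to the action on logarithmic series. -/
theorem MonicOp.opAct_laurent_of_dual {d : ℕ} {L : MonicOp RatFun d} {A : RatFun}
    (hA : ∀ y : RatFun, L.eval (A * y) = A * L.dual y) (u : LogSeries) :
    opAct (derivHom LogSeries) L.laurent (ofRat A • u) =
      ((-1) ^ d * ofRat A) • adjAct (derivHom LogSeries) L.laurent u := by
  have hpoly : opAct oreMul L.toPoly (Polynomial.C A) -
      Polynomial.C ((-1) ^ d * A) * adjAct oreMul L.toPoly 1 = 0 := by
    refine eq_zero_of_opAct_eq_zero deriv_ratFun_X fun y => ?_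
    change opAct (derivHom RatFun) _ y = 0
    rw [opAct_sub_left, opAct_opAct_oreMul isConnection_derivHom, opAct_C, opAct_C_mul,
      opAct_adjAct_one isConnection_derivHom, sub_eq_zero, smul_eq_mul, smul_eq_mul]
    have := hA y
    rw [L.eval_eq, L.dual_eq] at this
    refine Eq.trans this ?_
    ring
  have := congrArg (fun p => opAct (derivHom LogSeries) p u) hpoly
  simp only [opAct_sub_left, opAct_opAct_oreMul isConnection_derivHom, opAct_C, opAct_C_mul,
      opAct_adjAct_one isConnection_derivHom, opAct_zero_left, sub_eq_zero] at this
  rw [MonicOp.laurent, opAct_map, adjAct_map, algebraMap_smul, this, ← algebraMap_smul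
    (LaurentSeries ℚ) ((-1) ^ d * A)]
  simp

/-! ### Duality of normal forms -/

theorem adjAct_normPoly_succ (a : ℕ → LaurentSeries ℚ) (k : ℕ) (x : LogSeries) :
    adjAct (derivHom LogSeries) (normPoly a (k + 1)) (z⁻¹ • x) =
      -adjAct (derivHom LogSeries) (normPoly a k) (z⁻¹ • (Polynomial.C (a k) * theta x)) := by
  rw [normPoly, adjAct_C_mul, smul_inv_smul₀ z_ne_zero, adjAct_oreMul isConnection_derivHom,
    adjAct_C_mul, theta, derivHom_apply, ← Polynomial.smul_eq_C_mul, ← Polynomial.smul_eq_C_mul,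
    smul_comm (a k) z, inv_smul_smul₀ z_ne_zero]

/-- The adjoint of `𝒩_{n+1}` is, up to units, the operator `𝒩_{n+1}` of the reversed sequence. -/
theorem adjAct_normPoly {n : ℕ} {a b : ℕ → LaurentSeries ℚ}
    (hab : ∀ j, 1 ≤ j → j ≤ n + 1 → b j = a (n + 1 - j)) (v : LogSeries) :
    adjAct (derivHom LogSeries) (normPoly a (n + 1)) (z⁻¹ • (Polynomial.C (b 0) * v)) =
      (-1 : ℤ) ^ (n + 1) • (z⁻¹ • (Polynomial.C (b (n + 1)) * normalOp b (n + 1) v)) := by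
  have key : ∀ j ≤ n + 1,
      adjAct (derivHom LogSeries) (normPoly a (n + 1)) (z⁻¹ • (Polynomial.C (b 0) * v)) =
      (-1 : ℤ) ^ j • adjAct (derivHom LogSeries) (normPoly a (n + 1 - j))
        (z⁻¹ • (Polynomial.C (b j) * normalOp b j v)) := by
    intro j
    induction j with
    | zero =>
      intro _
      rw [pow_zero, one_smul, Nat.sub_zero]
      rfl
    | succ j ih =>
      intro hj
      rw [ih (by omega), show n + 1 - j = n + 1 - (j + 1) + 1 by omega, adjAct_normPoly_succ,
        ← hab (j + 1) (by omega) hj, pow_succ, mul_smul, neg_one_smul]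
      rfl
  rw [key (n + 1) le_rfl, Nat.sub_self, normPoly, adjAct_one]

/-- Under (P), the structure series form a palindrome, and the multiplier `A` in `L A = A L^∨`
is determined by the normal form up to a constant. -/
theorem NormalForm.duality {n : ℕ} {L : MonicOp RatFun (n + 1)} {y : ℕ → LogSeries}
    {a : ℕ → LaurentSeries ℚ} {α : ℕ → PowerSeries ℚ} (h : NormalForm L y a α) {A : RatFun}
    (hA0 : A ≠ 0) (hA : ∀ y : RatFun, L.eval (A * y) = A * L.dual y) :
    (∃ c : ℚ, c ≠ 0 ∧
      z * (∏ i ∈ Finset.range (n + 1), (z * a i))⁻¹ / ofRat A = cst c * a 0) ∧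
      ∀ k, 1 ≤ k → k ≤ n → α (n + 1 - k) = α k := by
  have hA' : ofRat A ≠ 0 := (map_ne_zero ofRat).2 hA0
  set c := (∏ i ∈ Finset.range (n + 1), (z * a i))⁻¹ with hc
  have hc0 : c ≠ 0 := inv_ne_zero h.prod_ne_zero
  set b : ℕ → LaurentSeries ℚ := fun j => if j = 0 then z * c / ofRat A else a (n + 1 - j) with hb
  have hb0 : b 0 = z * c / ofRat A := if_pos rfl
  have hbj : ∀ j, 1 ≤ j → b j = a (n + 1 - j) := fun j hj => if_neg (by omega)
  have hlast : b (n + 1) ≠ 0 := by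
    rw [hbj _ (by omega), Nat.sub_self]
    exact h.ne_zero 0 (by omega)
  -- By (P) the adjoint of `L` kills `y_k / A`; up to units, its value there is the value of
  -- `𝒩_{n+1}` for the sequence `b` at `y_k`.
  have hker : ∀ k ≤ n, normalOp b (n + 1) (y k) = 0 := by
    intro k hk
    have h1 := MonicOp.opAct_laurent_of_dual hA ((ofRat A)⁻¹ • y k)
    rw [smul_inv_smul₀ hA', h.sol k hk, h.laurent_eq, adjAct_C_mul, ← hc] at h1
    have h2 : c • ((ofRat A)⁻¹ • y k) = z⁻¹ • (Polynomial.C (b 0) * y k) := by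
      rw [hb0, ← Polynomial.smul_eq_C_mul, smul_smul, smul_smul]
      congr 1
      field_simp [z_ne_zero]
    rw [h2, adjAct_normPoly (fun j hj _ => hbj j hj)] at h1
    have h3 := (smul_eq_zero.1 h1.symm).resolve_left
      (mul_ne_zero (pow_ne_zero _ (neg_ne_zero.2 one_ne_zero)) hA')
    rcases neg_one_pow_eq_or ℤ (n + 1) with hs | hs <;> rw [hs] at h3 <;>
      simp only [one_smul, neg_smul, neg_eq_zero] at h3 <;>
      exact (mul_eq_zero.1 ((smul_eq_zero.1 h3).resolve_left (inv_ne_zero z_ne_zero))).resolve_left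
        (Polynomial.C_ne_zero.2 hlast)
  have := h.unique (b := b) (β := fun k => α (n + 1 - k))
    (by rw [hb0]; exact div_ne_zero (mul_ne_zero z_ne_zero hc0) hA')
    (fun k hk hkn => by rw [hbj k hk, h.eq_ofPS _ (by omega) (by omega)])
    (fun k hk hkn => h.constantCoeff _ (by omega) (by omega)) hker
  rwa [hb0] at this

/-! ### Symmetric powers of operators of order two -/

section SymPoly

variable {F : Type} [Field F] [Differential F]

/-- The operators `Q_i` of order `i` with `Q_i (w^n) = n (n-1) ⋯ (n-i+1) w^(n-i) w'^i` for all
solutions `w` of `w'' + a w' + b w = 0`. In particular `Q_{n+1}` is the `n`-th symmetric power of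
`∂^2 + a ∂ + b`. -/
def symPoly (n : ℕ) (a b : F) : ℕ → Polynomial F
  | 0 => 1
  | 1 => Polynomial.X
  | i + 2 => oreMul (symPoly n a b (i + 1)) +
      Polynomial.C ((i + 1 : ℕ) * a) * symPoly n a b (i + 1) +
      Polynomial.C ((i + 1 : ℕ) * ((n : F) - i) * b) * symPoly n a b i

theorem hasLead_symPoly (n : ℕ) (a b : F) : ∀ i, HasLead (symPoly n a b i) i 1
  | 0 => hasLead_one
  | 1 => hasLead_X
  | i + 2 => by
    have h := ((hasLead_symPoly n a b (i + 1)).oreMul.add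
      ((hasLead_symPoly n a b (i + 1)).C_mul ((i + 1 : ℕ) * a)).succ).add
      ((hasLead_symPoly n a b i).C_mul ((i + 1 : ℕ) * ((n : F) - i) * b)).succ.succ
    rwa [add_zero, add_zero] at h

theorem map_oreMul {K : Type} [Field K] [Differential K] [Algebra F K] [DifferentialAlgebra F K]
    (p : Polynomial F) :
    (oreMul p).map (algebraMap F K) = oreMul (p.map (algebraMap F K)) := by
  ext i
  rcases i with _ | i
  · rw [Polynomial.coeff_map, coeff_oreMul_zero, coeff_oreMul_zero, Polynomial.coeff_map,
      DifferentialAlgebra.deriv_algebraMap]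
  · rw [Polynomial.coeff_map, coeff_oreMul_succ, coeff_oreMul_succ, Polynomial.coeff_map,
      Polynomial.coeff_map, DifferentialAlgebra.deriv_algebraMap, map_add]

theorem map_symPoly {K : Type} [Field K] [Differential K] [Algebra F K] [DifferentialAlgebra F K]
    (n : ℕ) (a b : F) : ∀ i, (symPoly n a b i).map (algebraMap F K) =
      symPoly n (algebraMap F K a) (algebraMap F K b) i
  | 0 => by rw [symPoly, symPoly, Polynomial.map_one]
  | 1 => by rw [symPoly, symPoly, Polynomial.map_X]
  | i + 2 => by
    rw [symPoly, symPoly, Polynomial.map_add, Polynomial.map_add, Polynomial.map_mul,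
      Polynomial.map_mul, map_oreMul, map_symPoly n a b (i + 1), map_symPoly n a b i]
    simp

/-- If all coefficients of `Q_{n+1}` and `a` lie in a differential subfield, then so does `b`: the
coefficient of `∂^(n-1)` is the sum of a positive multiple of `b` and a term that only involves
`a`. -/
theorem coeff_symPoly {F₀ : Type} [Field F₀] [Differential F₀] [Algebra F₀ F]
    [DifferentialAlgebra F₀ F] (n : ℕ) (a₀ : F₀) (b : F) :
    ∀ i, (∃ r : F₀, (symPoly n (algebraMap F₀ F a₀) b (i + 1)).coeff i = algebraMap F₀ F r) ∧
      (i + 1 ≤ n → ∃ (r : F₀) (s : ℕ), 0 < s ∧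
        (symPoly n (algebraMap F₀ F a₀) b (i + 2)).coeff i = algebraMap F₀ F r + s * b) := by
  have h1 : ∀ i, ∃ r : F₀,
      (symPoly n (algebraMap F₀ F a₀) b (i + 1)).coeff i = algebraMap F₀ F r := by
    intro i
    induction i with
    | zero => exact ⟨0, by simp [symPoly]⟩
    | succ i ih =>
      obtain ⟨r, hr⟩ := ih
      refine ⟨r + (i + 1 : ℕ) * a₀, ?_⟩
      rw [symPoly, Polynomial.coeff_add, Polynomial.coeff_add, coeff_oreMul_succ,
        Polynomial.coeff_C_mul, Polynomial.coeff_C_mul, (hasLead_symPoly n _ b (i + 1)).2, hr,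
        (hasLead_symPoly n _ b i).succ.2, deriv_one]
      simp
  refine fun i => ⟨h1 i, ?_⟩
  induction i with
  | zero =>
    intro hn
    refine ⟨0, n, hn, ?_⟩
    simp [symPoly, coeff_oreMul_zero, deriv_zero]
  | succ i ih =>
    intro hi
    obtain ⟨r, s, hs, hr⟩ := ih (by omega)
    obtain ⟨q, hq⟩ := h1 (i + 1)
    refine ⟨r + q′ + (i + 2 : ℕ) * a₀ * q, s + (i + 2) * (n - (i + 1)), by omega, ?_⟩
    rw [symPoly, Polynomial.coeff_add, Polynomial.coeff_add, coeff_oreMul_succ,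
      Polynomial.coeff_C_mul, Polynomial.coeff_C_mul, hr, hq, (hasLead_symPoly n _ b (i + 1)).2,
      DifferentialAlgebra.deriv_algebraMap]
    push_cast [Nat.cast_sub (show i + 1 ≤ n by omega)]
    simp only [map_ofNat]
    ring

variable {A : Type} [CommRing A] [Algebra F A]

/-- A derivation of an `F`-algebra that extends the derivation of `F`. -/
structure IsDerivationOver (F : Type) [Field F] [Differential F] [Algebra F A] (δ : A →+ A) :
    Prop where
  mul : ∀ x y, δ (x * y) = x * δ y + y * δ x
  algebraMap : ∀ f : F, δ (algebraMap F A f) = algebraMap F A f′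

theorem IsDerivationOver.isConnection {δ : A →+ A} (h : IsDerivationOver F δ) :
    IsConnection (F := F) δ := by
  intro f m
  rw [Algebra.smul_def, Algebra.smul_def, Algebra.smul_def, h.mul, h.algebraMap]
  ring

theorem IsDerivationOver.one {δ : A →+ A} (h : IsDerivationOver F δ) : δ 1 = 0 := by
  have := h.mul 1 1
  simpa using this

theorem IsDerivationOver.natCast {δ : A →+ A} (h : IsDerivationOver F δ) (k : ℕ) :
    δ (k : A) = 0 := by
  rw [← nsmul_one, map_nsmul, h.one, smul_zero]

theorem IsDerivationOver.pow {δ : A →+ A} (h : IsDerivationOver F δ) (w : A) (k : ℕ) :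
    δ (w ^ (k + 1)) = (k + 1 : ℕ) * w ^ k * δ w := by
  induction k with
  | zero => simp
  | succ k ih =>
    rw [pow_succ, h.mul, ih]
    push_cast
    ring

theorem opAct_symPoly {δ : A →+ A} (h : IsDerivationOver F δ) {a b : F} {w : A}
    (hw : δ (δ w) = -(a • δ w) - b • w) (n : ℕ) :
    ∀ i, opAct δ (symPoly n a b i) (w ^ n) = n.descFactorial i * (w ^ (n - i) * δ w ^ i)
  | 0 => by rw [symPoly, opAct_one]; simp
  | 1 => by
    rw [symPoly, opAct_X]
    rcases n with _ | n
    · simp [h.one]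
    · rw [h.pow]
      simp [mul_assoc]
  | i + 2 => by
    rw [symPoly, opAct_add_left, opAct_add_left, opAct_oreMul h.isConnection, opAct_C_mul,
      opAct_C_mul, opAct_symPoly h hw n (i + 1), opAct_symPoly h hw n i]
    rcases lt_trichotomy n i with hn | rfl | hn
    · rw [Nat.descFactorial_of_lt hn, Nat.descFactorial_of_lt (show n < i + 1 by omega),
        Nat.descFactorial_of_lt (show n < i + 2 by omega)]
      simp
    · rw [Nat.descFactorial_of_lt (show n < n + 1 by omega),
        Nat.descFactorial_of_lt (show n < n + 2 by omega)]
      simp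
    · obtain ⟨m, rfl⟩ := Nat.exists_eq_add_of_lt hn
      rw [show i + m + 1 - (i + 1) = m by omega, show i + m + 1 - i = m + 1 by omega]
      have hd1 : (i + m + 1).descFactorial (i + 1) = (m + 1) * (i + m + 1).descFactorial i := by
        rw [Nat.descFactorial_succ]; congr 1; omega
      have hd2 : (i + m + 1).descFactorial (i + 2) = m * (i + m + 1).descFactorial (i + 1) := by
        rw [Nat.descFactorial_succ]; congr 1; omega
      rw [hd2, hd1, h.mul, h.natCast, h.mul, h.pow, hw]
      rcases m with _ | m
      · simp only [Algebra.smul_def, h.one, pow_zero, map_mul, map_sub, map_natCast]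
        push_cast
        ring
      · rw [h.pow, show i + (m + 1) + 1 - (i + 2) = m by omega]
        simp only [Algebra.smul_def, map_mul, map_sub, map_natCast]
        push_cast
        ring

theorem opAct_symPoly_eq_zero {δ : A →+ A} (h : IsDerivationOver F δ) {a b : F} {w : A}
    (hw : δ (δ w) = -(a • δ w) - b • w) (n : ℕ) :
    opAct δ (symPoly n a b (n + 1)) (w ^ n) = 0 := by
  rw [opAct_symPoly h hw, Nat.descFactorial_of_lt n.lt_succ_self]
  simp

end SymPoly

/-! ### The derivation on the symmetric algebra -/

section SymDeriv

variable {d : ℕ} (P : MonicOp RatFun (d + 1))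

theorem coeff_sum_monomial_deriv (p : MvPolynomial (Fin (d + 1)) RatFun) (m : Fin (d + 1) →₀ ℕ) :
    MvPolynomial.coeff m (∑ m ∈ p.support, MvPolynomial.monomial m (MvPolynomial.coeff m p)′) =
      (MvPolynomial.coeff m p)′ := by
  classical
  rw [MvPolynomial.coeff_sum]
  simp only [MvPolynomial.coeff_monomial]
  rw [Finset.sum_ite_eq']
  split_ifs with h
  · rfl
  · rw [MvPolynomial.notMem_support_iff.1 h, deriv_zero]

/-- The derivation of the symmetric algebra as an additive map. -/
def MonicOp.symHom : MvPolynomial (Fin (d + 1)) RatFun →+ MvPolynomial (Fin (d + 1)) RatFun where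
  toFun := P.symDeriv
  map_zero' := by simp [MonicOp.symDeriv]
  map_add' p q := by
    have h : ∑ m ∈ (p + q).support,
          MvPolynomial.monomial m (MvPolynomial.coeff m (p + q))′ =
        ∑ m ∈ p.support, MvPolynomial.monomial m (MvPolynomial.coeff m p)′ +
          ∑ m ∈ q.support, MvPolynomial.monomial m (MvPolynomial.coeff m q)′ := by
      ext m
      rw [MvPolynomial.coeff_add, coeff_sum_monomial_deriv, coeff_sum_monomial_deriv,
        coeff_sum_monomial_deriv, MvPolynomial.coeff_add, deriv_add]
    simp only [MonicOp.symDeriv, h, map_add, add_mul, Finset.sum_add_distrib]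
    abel

theorem MonicOp.symHom_apply (p : MvPolynomial (Fin (d + 1)) RatFun) :
    P.symHom p = P.symDeriv p := rfl

theorem MonicOp.symDeriv_X (j : Fin (d + 1)) :
    P.symDeriv (MvPolynomial.X j) = P.derivBasis j := by
  classical
  have h : ∑ m ∈ (MvPolynomial.X j : MvPolynomial (Fin (d + 1)) RatFun).support,
      MvPolynomial.monomial m (MvPolynomial.coeff m
        (MvPolynomial.X j : MvPolynomial (Fin (d + 1)) RatFun))′ = 0 := by
    ext m
    rw [coeff_sum_monomial_deriv, MvPolynomial.coeff_X, MvPolynomial.coeff_zero]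
    split_ifs
    · exact deriv_one
    · exact deriv_zero
  rw [MonicOp.symDeriv, h, zero_add, Finset.sum_eq_single j]
  · simp
  · intro i _ hi
    rw [MvPolynomial.pderiv_X_of_ne hi.symm, zero_mul]
  · simp

theorem MonicOp.isDerivationOver_symHom : IsDerivationOver RatFun P.symHom where
  mul p q := by
    have h : ∑ m ∈ (p * q).support, MvPolynomial.monomial m (MvPolynomial.coeff m (p * q))′ =
        p * ∑ m ∈ q.support, MvPolynomial.monomial m (MvPolynomial.coeff m q)′ +
          q * ∑ m ∈ p.support, MvPolynomial.monomial m (MvPolynomial.coeff m p)′ := by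
      classical
      ext m
      rw [coeff_sum_monomial_deriv, mul_comm q, MvPolynomial.coeff_add, MvPolynomial.coeff_mul,
        MvPolynomial.coeff_mul, MvPolynomial.coeff_mul, map_sum, ← Finset.sum_add_distrib]
      refine Finset.sum_congr rfl fun x _ => ?_
      rw [coeff_sum_monomial_deriv, coeff_sum_monomial_deriv, deriv_mul]
      ring
    simp only [MonicOp.symHom_apply, MonicOp.symDeriv, h, Derivation.leibniz, smul_eq_mul, add_mul,
      Finset.sum_add_distrib, mul_add, Finset.mul_sum]
    have h1 : ∀ p q : MvPolynomial (Fin (d + 1)) RatFun, ∀ i : Fin (d + 1),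
      p * MvPolynomial.pderiv i q * P.derivBasis i =
        p * (MvPolynomial.pderiv i q * P.derivBasis i) := fun _ _ _ => mul_assoc _ _ _
    simp only [h1]
    abel
  algebraMap f := by
    classical
    rw [MvPolynomial.algebraMap_eq, MonicOp.symHom_apply, MonicOp.symDeriv]
    simp only [MvPolynomial.pderiv_C, zero_mul, Finset.sum_const_zero, add_zero]
    ext m
    rw [coeff_sum_monomial_deriv, MvPolynomial.coeff_C, MvPolynomial.coeff_C]
    split_ifs
    · rfl
    · exact deriv_zero

end SymDeriv

theorem MonicOp.symHom_symHom_X (P : MonicOp RatFun 2) :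
    P.symHom (P.symHom (MvPolynomial.X 0)) =
      -(P.coeff 1 • P.symHom (MvPolynomial.X 0)) - P.coeff 0 • MvPolynomial.X 0 := by
  have h0 : P.symHom (MvPolynomial.X 0) = MvPolynomial.X 1 := by
    rw [MonicOp.symHom_apply, MonicOp.symDeriv_X, MonicOp.derivBasis]
    rfl
  rw [h0, MonicOp.symHom_apply, MonicOp.symDeriv_X, MonicOp.derivBasis, dif_neg (by simp),
    Fin.sum_univ_two, MvPolynomial.smul_eq_C_mul, MvPolynomial.smul_eq_C_mul]
  ring

/-- The vectors `e^n, ∂ e^n, …, ∂^n e^n` of the symmetric power are independent. -/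
theorem MonicOp.eq_zero_of_opAct_symHom {P : MonicOp RatFun 2} {n : ℕ} {p : Polynomial RatFun}
    (hp : p.natDegree < n + 1) (h : opAct P.symHom p (MvPolynomial.X 0 ^ n) = 0) : p = 0 := by
  obtain ⟨r, rfl⟩ := exists_eq_sum_of_hasLead (d := n + 1) (l := fun _ => 1)
    (N := symPoly n (P.coeff 1) (P.coeff 0)) (fun _ _ => one_ne_zero)
    (fun i _ => hasLead_symPoly _ _ _ i)
    (Polynomial.degree_le_natDegree.trans_lt (by exact_mod_cast hp))
  have h0 : P.symHom (MvPolynomial.X 0) = MvPolynomial.X 1 := by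
    rw [MonicOp.symHom_apply, MonicOp.symDeriv_X, MonicOp.derivBasis]
    rfl
  have h1 := congrArg (MvPolynomial.aeval ![(1 : Polynomial RatFun), Polynomial.X]) h
  simp only [opAct_sum_left, opAct_C_mul,
    opAct_symPoly P.isDerivationOver_symHom P.symHom_symHom_X, h0, map_sum, map_smul, map_mul,
    map_pow, MvPolynomial.aeval_X, map_natCast, map_zero] at h1
  have hco : ∀ i j, (r i • ((n.descFactorial i : Polynomial RatFun) *
      ((1 : Polynomial RatFun) ^ (n - i) * Polynomial.X ^ i))).coeff j =
        if j = i then r i * n.descFactorial i else 0 := by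
    intro i j
    rw [Polynomial.coeff_smul, ← Polynomial.C_eq_natCast, Polynomial.coeff_C_mul, one_pow, one_mul,
      Polynomial.coeff_X_pow, smul_eq_mul, mul_ite, mul_ite, mul_one, mul_zero, mul_zero]
  refine Finset.sum_eq_zero fun i hi => ?_
  have h2 := congrArg (fun q => Polynomial.coeff q i) h1
  simp only [Polynomial.finsetSum_coeff] at h2
  rw [Finset.sum_eq_single i] at h2
  · have h3 : r i * (n.descFactorial i : RatFun) = 0 := by
      have := (hco i i).symm.trans h2
      rwa [if_pos rfl] at this
    rcases mul_eq_zero.1 h3 with h4 | h4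
    · rw [h4, map_zero, zero_mul]
    · rw [Nat.cast_eq_zero, Nat.descFactorial_eq_zero_iff_lt] at h4
      rw [Finset.mem_range] at hi
      omega
  · intro j _ hj
    exact (hco j i).trans (if_neg hj.symm)
  · intro hi'
    exact absurd hi hi'

theorem MonicOp.isSymPower_iff {n : ℕ} {P : MonicOp RatFun 2} {S : MonicOp RatFun (n + 1)} :
    P.IsSymPower n S ↔ S.toPoly = symPoly n (P.coeff 1) (P.coeff 0) (n + 1) := by
  have hQ : opAct P.symHom (symPoly n (P.coeff 1) (P.coeff 0) (n + 1)) (MvPolynomial.X 0 ^ n) = 0 :=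
    opAct_symPoly_eq_zero P.isDerivationOver_symHom P.symHom_symHom_X n
  constructor
  · rintro ⟨hS, -⟩
    rw [S.act_eq] at hS
    rw [← sub_eq_zero]
    refine MonicOp.eq_zero_of_opAct_symHom (P := P)
      (S.hasLead_toPoly.natDegree_sub_lt (hasLead_symPoly _ _ _ _)) ?_
    rw [opAct_sub_left, hQ, sub_zero]
    exact hS
  · intro h
    refine ⟨?_, fun k hk T hT => ?_⟩
    · rw [S.act_eq, h]
      exact hQ
    · rw [T.act_eq] at hT
      exact T.hasLead_toPoly.ne_zero one_ne_zero
        (MonicOp.eq_zero_of_opAct_symHom (P := P) (T.hasLead_toPoly.1.trans_lt hk) hT)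

/-! ### Solutions of symmetric powers -/

theorem opAct_nsmul {F M : Type} [Field F] [AddCommGroup M] [Module F M] (δ : M →+ M)
    (p : Polynomial F) (k : ℕ) (m : M) : opAct δ p (k • m) = k • opAct δ p m := by
  induction k with
  | zero => rw [zero_smul, zero_smul, opAct_zero_right]
  | succ k ih => rw [succ_nsmul, succ_nsmul, opAct_add_right, ih]

/-- If `h` and `h t` solve an operator of order two, then its `n`-th symmetric power annihilates
`h^n, h^n t, …, h^n t^n`. The proof adjoins a constant `c` and considers the coefficients of
`(h + c h t)^n`. -/
theorem opAct_symPoly_mul_pow {F R : Type} [Field F] [CharZero F] [Differential F] [CommRing R]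
    [Differential R] [Algebra F R] [DifferentialAlgebra F R] {a b : F} {h t : R}
    (hh : h′′ = -(a • h′) - b • h) (ht : (h * t)′′ = -(a • (h * t)′) - b • (h * t)) {n k : ℕ}
    (hk : k ≤ n) :
    opAct (derivHom R) (symPoly n a b (n + 1)) (h ^ n * t ^ k) = 0 := by
  let δ : Polynomial R →+ Polynomial R :=
    { toFun := fun p => Differential.mapCoeffs p
      map_zero' := map_zero _
      map_add' := map_add _ }
  have hδ : ∀ p j, (δ p).coeff j = (p.coeff j)′ := fun p j => rfl
  have hder : IsDerivationOver F δ := by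
    refine ⟨fun p q => ?_, fun f => ?_⟩
    · change Differential.mapCoeffs (p * q) = p * Differential.mapCoeffs q +
        q * Differential.mapCoeffs p
      rw [Derivation.leibniz, smul_eq_mul, smul_eq_mul]
    · rw [IsScalarTower.algebraMap_apply F R (Polynomial R),
        IsScalarTower.algebraMap_apply F R (Polynomial R), Polynomial.algebraMap_eq]
      change Differential.mapCoeffs _ = _
      rw [Differential.mapCoeffs_C, DifferentialAlgebra.deriv_algebraMap]
  have hcoeff : ∀ (p : Polynomial F) (w : Polynomial R) (j : ℕ),
      (opAct δ p w).coeff j = opAct (derivHom R) p (w.coeff j) := by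
    intro p w j
    have hit : ∀ i, (δ^[i] w).coeff j = (derivHom R)^[i] (w.coeff j) := by
      intro i
      induction i with
      | zero => rfl
      | succ i ih => rw [Function.iterate_succ_apply', Function.iterate_succ_apply', hδ, ih,
          derivHom_apply]
    induction p using Polynomial.induction_on' with
    | add p q hp hq => rw [opAct_add_left, opAct_add_left, Polynomial.coeff_add, hp, hq]
    | monomial i c => rw [opAct_monomial, opAct_monomial, Polynomial.coeff_smul, hit]
  set w : Polynomial R := Polynomial.C h + Polynomial.X * Polynomial.C (h * t) with hwdef
  have hw : δ (δ w) = -(a • δ w) - b • w := by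
    ext1 j
    rw [hδ, hδ, Polynomial.coeff_sub, Polynomial.coeff_neg, Polynomial.coeff_smul,
      Polynomial.coeff_smul, hδ]
    rcases j with _ | _ | j
    · simpa [hwdef] using hh
    · simpa [hwdef, Polynomial.coeff_X_mul, Polynomial.coeff_C] using ht
    · simp [hwdef, Polynomial.coeff_X_mul, deriv_zero]
  have key := congrArg (fun p => Polynomial.coeff p k) (opAct_symPoly_eq_zero hder hw n)
  simp only [hcoeff, Polynomial.coeff_zero] at key
  have hwn : (w ^ n).coeff k = n.choose k • (h ^ n * t ^ k) := by
    have : w = Polynomial.C h * (1 + Polynomial.X : Polynomial R).comp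
        (Polynomial.C t * Polynomial.X) := by
      simp [hwdef, mul_add]
      ring
    rw [this, mul_pow, ← Polynomial.C_pow, Polynomial.coeff_C_mul, ← Polynomial.pow_comp,
      Polynomial.comp_C_mul_X_coeff, Polynomial.coeff_one_add_X_pow, nsmul_eq_mul]
    ring
  rw [hwn, opAct_nsmul, ← Nat.cast_smul_eq_nsmul F] at key
  exact (smul_eq_zero.1 key).resolve_left (Nat.cast_ne_zero.2 (Nat.choose_pos hk).ne')

instance : CharZero (LaurentSeries ℚ) := charZero_of_injective_ringHom cst.injective

/-! ### Power series -/

/-- The equation `y + y^2 = x` has a solution for every power series `x` without constant term: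
`y = x c(-x)`, where `c` is the generating function of the Catalan numbers. -/
theorem exists_add_sq_eq {x : PowerSeries ℤ} (hx : PowerSeries.constantCoeff x = 0) :
    ∃ y : PowerSeries ℤ, PowerSeries.constantCoeff y = 0 ∧ y + y ^ 2 = x := by
  have hs : PowerSeries.HasSubst (-x) :=
    PowerSeries.HasSubst.of_constantCoeff_zero' (by rw [map_neg, hx, neg_zero])
  set C : PowerSeries ℤ := PowerSeries.catalanSeries.map (Nat.castRingHom ℤ) with hC
  have h1 : C ^ 2 * PowerSeries.X + 1 = C := by
    rw [hC]
    conv_rhs => rw [← PowerSeries.catalanSeries_sq_mul_X_add_one]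
    simp
  have h2 := congrArg (PowerSeries.substAlgHom hs) h1
  rw [map_add, map_mul, map_pow, map_one, PowerSeries.substAlgHom_X] at h2
  refine ⟨x * PowerSeries.substAlgHom hs C, by rw [map_mul, hx, zero_mul], ?_⟩
  linear_combination (-x) * h2

theorem NIntegral.exists_sq_eq {α : PowerSeries ℚ} (hα : NIntegral α)
    (h1 : PowerSeries.constantCoeff α = 1) :
    ∃ h : PowerSeries ℚ, h ^ 2 = α ∧ PowerSeries.constantCoeff h = 1 ∧ NIntegral h := by
  obtain ⟨N, hN, hk⟩ := hα
  choose k hk using hk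
  -- After substituting `4 N z` for `z`, the series is congruent to `1` modulo `4`.
  set x : PowerSeries ℤ := PowerSeries.mk fun m => if m = 0 then 0 else 4 ^ (m - 1) * k m with hx
  have hx0 : PowerSeries.constantCoeff x = 0 := by
    rw [← PowerSeries.coeff_zero_eq_constantCoeff_apply, hx, PowerSeries.coeff_mk, if_pos rfl]
  obtain ⟨y, hy0, hy⟩ := exists_add_sq_eq hx0
  have hM : (4 * N : ℚ) ≠ 0 := by positivity
  have hα : PowerSeries.rescale (4 * N : ℚ) α = (1 + 4 * x).map (Int.castRingHom ℚ) := by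
    ext m
    rw [PowerSeries.coeff_rescale, PowerSeries.coeff_map, map_add,
      show (4 : PowerSeries ℤ) = PowerSeries.C 4 from (map_ofNat PowerSeries.C 4).symm,
      PowerSeries.coeff_C_mul, hx, PowerSeries.coeff_mk]
    rcases m with _ | m
    · simp [h1]
    · rw [if_neg m.succ_ne_zero, mul_pow, mul_assoc, hk, PowerSeries.coeff_one,
        if_neg m.succ_ne_zero, Nat.add_sub_cancel]
      simp
      ring
  have hsq : (1 + 2 * y) ^ 2 = 1 + 4 * x := by rw [← hy]; ring
  refine ⟨PowerSeries.rescale (4 * N : ℚ)⁻¹ ((1 + 2 * y).map (Int.castRingHom ℚ)), ?_, ?_,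
    4 * N, by omega, fun m => ⟨PowerSeries.coeff m (1 + 2 * y), ?_⟩⟩
  · rw [← map_pow, ← map_pow, hsq, ← hα, PowerSeries.rescale_rescale, mul_inv_cancel₀ hM,
      PowerSeries.rescale_one, RingHom.id_apply]
  · rw [← PowerSeries.coeff_zero_eq_constantCoeff_apply, PowerSeries.coeff_rescale,
      PowerSeries.coeff_map, PowerSeries.coeff_zero_eq_constantCoeff_apply, map_add, map_mul, hy0]
    simp
  · rw [PowerSeries.coeff_rescale, PowerSeries.coeff_map, ← mul_assoc, Nat.cast_mul, Nat.cast_ofNat,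
      ← mul_pow, mul_inv_cancel₀ hM, one_pow, one_mul]
    rfl

theorem exists_subst_eq_X {q : PowerSeries ℚ} (h0 : PowerSeries.constantCoeff q = 0)
    (h1 : PowerSeries.coeff 1 q = 1) :
    ∃ p : PowerSeries ℚ, PowerSeries.constantCoeff p = 0 ∧
      PowerSeries.subst p q = PowerSeries.X ∧ PowerSeries.subst q p = PowerSeries.X := by
  have hu : IsUnit (PowerSeries.coeff 1 q) := by rw [h1]; exact isUnit_one
  exact ⟨q.substInvOfIsUnit hu, q.constantCoeff_substInvOfIsUnit hu,
    q.subst_substInvOfIsUnit_right h0 hu, q.subst_substInvOfIsUnit_left h0 hu⟩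

theorem subst_one {p : PowerSeries ℚ} (hp : PowerSeries.constantCoeff p = 0) :
    PowerSeries.subst p (1 : PowerSeries ℚ) = (1 : PowerSeries ℚ) := by
  rw [← PowerSeries.coe_substAlgHom (PowerSeries.HasSubst.of_constantCoeff_zero' hp), map_one]

theorem eq_one_of_subst_eq_one {p q s : PowerSeries ℚ} (hp : PowerSeries.constantCoeff p = 0)
    (hq : PowerSeries.constantCoeff q = 0) (hpq : PowerSeries.subst q p = PowerSeries.X)
    (hs : PowerSeries.subst p s = (1 : PowerSeries ℚ)) : s = 1 := by
  have h := PowerSeries.subst_comp_subst_apply (PowerSeries.HasSubst.of_constantCoeff_zero' hp)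
    (PowerSeries.HasSubst.of_constantCoeff_zero' hq) s
  rw [hs, hpq, subst_one hq, PowerSeries.X_subst] at h
  exact h.symm

/-! ### Flags given by powers -/

/-- The sequence `b, s, s, s, …`. -/
def powSeq (b s : LaurentSeries ℚ) : ℕ → LaurentSeries ℚ := fun k => if k = 0 then b else s

theorem powSeq_zero (b s : LaurentSeries ℚ) : powSeq b s 0 = b := rfl

theorem powSeq_pos (b s : LaurentSeries ℚ) {k : ℕ} (hk : 1 ≤ k) : powSeq b s k = s :=
  if_neg (by omega)

/-- The functions `e t^k / k!`. -/
def powFlag (e : LaurentSeries ℚ) (t : LogSeries) (k : ℕ) : LogSeries :=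
  Polynomial.C e * (Polynomial.C (cst (1 / (k.factorial : ℚ))) * t ^ k)

theorem theta_pow (t : LogSeries) (k : ℕ) :
    theta (t ^ (k + 1)) = (k + 1 : ℕ) * t ^ k * theta t := by
  induction k with
  | zero => simp
  | succ k ih =>
    rw [pow_succ, theta_mul, ih, Nat.cast_succ (k + 1), pow_succ]
    ring

/-- If `s ϑ t = 1`, then `s ϑ` acts on polynomials in `t` as `d/dt`. -/
theorem powFlag_adapted {e s : LaurentSeries ℚ} (he : e ≠ 0) {t : LogSeries}
    (ht : Polynomial.C s * theta t = 1) (k : ℕ) :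
    Polynomial.C (powSeq e⁻¹ s k) * normalOp (powSeq e⁻¹ s) k (powFlag e t k) = 1 := by
  have key : ∀ j, j ≤ k →
      Polynomial.C (powSeq e⁻¹ s j) * normalOp (powSeq e⁻¹ s) j (powFlag e t k) =
      Polynomial.C (cst (1 / (k.factorial : ℚ) * k.descFactorial j)) * t ^ (k - j) := by
    intro j
    induction j with
    | zero =>
      intro _
      rw [powSeq_zero, normalOp, powFlag, ← mul_assoc, ← Polynomial.C_mul, inv_mul_cancel₀ he]
      simp
    | succ j ih =>
      intro hj
      rw [powSeq_pos _ _ (Nat.succ_pos j), normalOp, ih (by omega), theta_cst_mul,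
        show k - j = k - (j + 1) + 1 by omega, theta_pow, Nat.descFactorial_succ,
        show k - (j + 1) + 1 = k - j by omega]
      have h1 : Polynomial.C (cst (1 / (k.factorial : ℚ) * ((k - j) * k.descFactorial j : ℕ))) =
          Polynomial.C (cst (1 / (k.factorial : ℚ) * k.descFactorial j)) *
            ((k - j : ℕ) : LogSeries) := by
        rw [← Polynomial.C_eq_natCast, ← Polynomial.C_mul, ← map_natCast cst, ← cst.map_mul]
        push_cast
        ring_nf
      rw [h1]
      generalize Polynomial.C (cst (1 / (k.factorial : ℚ) * k.descFactorial j)) = c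
      linear_combination (c * ((k - j : ℕ) : LogSeries) * t ^ (k - (j + 1))) * ht
  rw [key k le_rfl, Nat.sub_self, pow_zero, mul_one, Nat.descFactorial_self,
    one_div_mul_cancel (by exact_mod_cast Nat.factorial_ne_zero k), map_one, map_one]

theorem natDegree_powFlag {e : LaurentSeries ℚ} (he : e ≠ 0) {t : LogSeries}
    (ht : t.natDegree = 1) (k : ℕ) : (powFlag e t k).natDegree = k := by
  have hk : (1 / (k.factorial : ℚ)) ≠ 0 := by
    have := Nat.factorial_ne_zero k
    positivity
  rw [powFlag, natDegree_C_mul_logSeries he, natDegree_C_mul_logSeries ((map_ne_zero cst).2 hk),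
    Polynomial.natDegree_pow, ht, mul_one]

theorem iterate_derivHom_cst_mul (i : ℕ) (c : ℚ) (u : LogSeries) :
    (derivHom LogSeries)^[i] (Polynomial.C (cst c) * u) =
      Polynomial.C (cst c) * (derivHom LogSeries)^[i] u := by
  induction i with
  | zero => rfl
  | succ i ih =>
    rw [Function.iterate_succ_apply', ih, derivHom_apply, deriv_mul, deriv_log_C, deriv_cst,
      map_zero, mul_zero, add_zero, Function.iterate_succ_apply', derivHom_apply]

theorem opAct_cst_mul (p : Polynomial (LaurentSeries ℚ)) (c : ℚ) (u : LogSeries) :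
    opAct (derivHom LogSeries) p (Polynomial.C (cst c) * u) =
      Polynomial.C (cst c) * opAct (derivHom LogSeries) p u := by
  simp only [opAct, Polynomial.sum, iterate_derivHom_cst_mul, Finset.mul_sum, mul_smul_comm]

theorem opAct_powFlag_eq_zero {p : Polynomial (LaurentSeries ℚ)} {e : LaurentSeries ℚ}
    {t : LogSeries} {k : ℕ}
    (h : opAct (derivHom LogSeries) p (Polynomial.C e * t ^ k) = 0) :
    opAct (derivHom LogSeries) p (powFlag e t k) = 0 := by
  rw [powFlag, mul_left_comm, opAct_cst_mul, h, mul_zero]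

/-- If the solutions of `L` are the functions `e t^k`, then all structure series agree. -/
theorem NormalForm.eq_of_pow {n : ℕ} {L : MonicOp RatFun (n + 1)} {y : ℕ → LogSeries}
    {a : ℕ → LaurentSeries ℚ} {α : ℕ → PowerSeries ℚ} (h : NormalForm L y a α)
    {e : LaurentSeries ℚ} (he : e ≠ 0) {t : LogSeries} (htd : t.natDegree = 1)
    {β : PowerSeries ℚ} (hβ : PowerSeries.constantCoeff β = 1)
    (ht : Polynomial.C (ofPS β) * theta t = 1)
    (hL : ∀ k ≤ n, opAct (derivHom LogSeries) L.laurent (Polynomial.C e * t ^ k) = 0) :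
    ∀ k, 1 ≤ k → k ≤ n → α k = β := by
  intro k hk hkn
  obtain ⟨c, -, hc⟩ := normalForm_unique (n := n) (b := a) (fun k _ => natDegree_powFlag he htd k)
    (fun k _ => powFlag_adapted he ht k) (h.ne_zero 0 (Nat.zero_le n))
    (fun k hk hkn => ⟨α k, by rw [h.constantCoeff k hk hkn]; exact one_ne_zero, h.eq_ofPS k hk hkn⟩)
    (fun k hk => (h.opAct_eq_zero_iff _).1 (opAct_powFlag_eq_zero (hL k hk))) k hkn
  rw [powSeq_pos _ _ hk, h.eq_ofPS k hk hkn] at hc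
  exact eq_of_ofPS_eq_cst_mul (h.constantCoeff k hk hkn) hβ hc

/-! ### Tensor products with algebraic functions -/

theorem coeff_iterate_oreMul_C {F : Type} [Field F] [Differential F] (c : F) (i : ℕ) :
    (oreMul^[i + 1] (Polynomial.C c)).coeff i = (i + 1 : ℕ) * c′ := by
  induction i with
  | zero => rw [Function.iterate_one, coeff_oreMul_zero]; simp
  | succ i ih =>
    rw [Function.iterate_succ_apply', coeff_oreMul_succ, ih]
    have := ((hasLead_C c).iterate_oreMul (i + 1)).2
    rw [zero_add] at this
    rw [this]
    push_cast
    ring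

theorem coeff_opAct_oreMul_C {F : Type} [Field F] [Differential F] {p : Polynomial F} {n : ℕ}
    (hp : HasLead p (n + 1) 1) (c : F) :
    (opAct oreMul p (Polynomial.C c)).coeff n = (n + 1 : ℕ) * c′ + p.coeff n * c := by
  rw [opAct_eq_sum_range _ _ _ (Nat.lt_succ_of_le hp.1), Finset.sum_range_succ,
    Finset.sum_range_succ, Polynomial.coeff_add, Polynomial.coeff_add, Polynomial.finsetSum_coeff,
    Finset.sum_eq_zero, zero_add, Polynomial.coeff_smul, Polynomial.coeff_smul, hp.2,
    coeff_iterate_oreMul_C]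
  · have := ((hasLead_C c).iterate_oreMul n).2
    rw [zero_add] at this
    rw [this, smul_eq_mul, smul_eq_mul]
    ring
  · intro i hi
    rw [Finset.mem_range] at hi
    have := ((hasLead_C c).iterate_oreMul i).1
    rw [Polynomial.coeff_smul,
      Polynomial.coeff_eq_zero_of_natDegree_lt (p := oreMul^[i] (Polynomial.C c)) (by omega),
      smul_zero]

instance : CharZero AlgFun := charZero_of_injective_ringHom (algebraMap RatFun AlgFun).injective

theorem opAct_algebraMap {F A : Type} [Field F] [Differential F] [CommRing A] [Differential A]
    [Algebra F A] [DifferentialAlgebra F A] (p : Polynomial F) (y : F) :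
    opAct (derivHom A) p (algebraMap F A y) = algebraMap F A (opAct (derivHom F) p y) := by
  have key : ∀ i, (derivHom A)^[i] (algebraMap F A y) = algebraMap F A ((derivHom F)^[i] y) := by
    intro i
    induction i with
    | zero => rfl
    | succ i ih => rw [Function.iterate_succ_apply', ih, derivHom_apply,
        DifferentialAlgebra.deriv_algebraMap, Function.iterate_succ_apply', derivHom_apply]
  simp only [opAct, Polynomial.sum, key, map_sum, Algebra.smul_def, map_mul,
    Algebra.algebraMap_self, RingHom.id_apply]

/-- If `g L g⁻¹` has rational coefficients, then the logarithmic derivative `u` of `g` is rational,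
by comparison of the second highest coefficients, and `L` arises by substituting `∂ + u` for
`∂`. -/
theorem MonicOp.IsTensor.exists_twist {n : ℕ} {L S : MonicOp RatFun (n + 1)} {g : AlgFun}
    (hg : g ≠ 0) (h : L.IsTensor g S) : ∃ u : RatFun, twist u S.toPoly = L.toPoly := by
  set ψ := algebraMap RatFun AlgFun with hψ
  have hS := S.hasLead_toPoly.map ψ
  have hL := L.hasLead_toPoly.map ψ
  rw [map_one] at hS hL
  have hact : ∀ y : AlgFun, opAct (derivHom AlgFun) (S.toPoly.map ψ) y =
      g * opAct (derivHom AlgFun) (L.toPoly.map ψ) (g⁻¹ * y) := by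
    intro y
    rw [opAct_map, opAct_map]
    have := h y
    rwa [S.eval_eq, L.eval_eq] at this
  have hpoly : S.toPoly.map ψ - Polynomial.C g * opAct oreMul (L.toPoly.map ψ)
      (Polynomial.C g⁻¹) = 0 := by
    refine eq_zero_of_opAct_eq_zero (x := ψ RatFunc.X) ?_ fun y => ?_
    · rw [hψ, DifferentialAlgebra.deriv_algebraMap, deriv_ratFun_X, map_one]
    · change opAct (derivHom AlgFun) _ y = 0
      rw [opAct_sub_left, opAct_C_mul, opAct_opAct_oreMul isConnection_derivHom, opAct_C, hact,
        smul_eq_mul, smul_eq_mul, sub_self]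
  have hn : ((n : AlgFun) + 1) ≠ 0 := by exact_mod_cast n.succ_ne_zero
  have hn' : ((n : RatFun) + 1) ≠ 0 := by exact_mod_cast n.succ_ne_zero
  set u : RatFun := (L.toPoly.coeff n - S.toPoly.coeff n) / (n + 1) with hu
  have hgu : g′ = ψ u * g := by
    have h1 := congrArg (fun p => Polynomial.coeff p n) (sub_eq_zero.1 hpoly)
    simp only [Polynomial.coeff_C_mul, coeff_opAct_oreMul_C hL, Polynomial.coeff_map] at h1
    have h2 : (g⁻¹)′ = -g′ / g ^ 2 := by
      rw [inv_eq_one_div, deriv_div_eq hg, deriv_one]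
      ring
    rw [h2] at h1
    rw [hu, map_div₀, map_sub, h1, map_add, map_natCast, map_one]
    push_cast
    field_simp
    ring
  refine ⟨u, ?_⟩
  rw [← sub_eq_zero]
  refine eq_zero_of_opAct_eq_zero deriv_ratFun_X fun y => ?_
  change opAct (derivHom RatFun) _ y = 0
  apply (algebraMap RatFun AlgFun).injective
  rw [← opAct_algebraMap, opAct_sub_left, opAct_twist isConnection_derivHom, map_zero, sub_eq_zero]
  have h3 := opAct_shift_of_smul (isConnection_derivHom (F := AlgFun)) hgu (S.toPoly.map ψ) (ψ y)
  rw [hact, smul_eq_mul, smul_eq_mul, inv_mul_cancel_left₀ hg] at h3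
  have h4 := mul_left_cancel₀ hg h3
  have h5 : shift (derivHom AlgFun) (ψ u) = shift (derivHom AlgFun) u := by
    ext m
    rw [shift_apply, shift_apply, hψ, algebraMap_smul]
  rw [h5, opAct_map, opAct_map] at h4
  exact h4.symm

theorem opAct_laurent_of_twist {d : ℕ} {L S : MonicOp RatFun d} {u : RatFun}
    (h : twist u S.toPoly = L.toPoly) {A : Type} [CommRing A] [Differential A] [Algebra RatFun A]
    [Algebra (LaurentSeries ℚ) A] [IsScalarTower RatFun (LaurentSeries ℚ) A]
    [DifferentialAlgebra RatFun A] (w : A) :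
    opAct (derivHom A) L.laurent w = opAct (shift (derivHom A) (ofRat u)) S.laurent w := by
  have h5 : shift (derivHom A) (ofRat u) = shift (derivHom A) u := by
    ext m
    rw [shift_apply, shift_apply, algebraMap_smul]
  rw [h5, MonicOp.laurent, opAct_map, ← h, opAct_twist isConnection_derivHom, MonicOp.laurent,
    opAct_map]

/-- If a product of factors `z ∂ a_i` kills a nonzero element, where `∂` acts by a connection on
`ℚ((z))`, then the connection has a nonzero horizontal section. -/
theorem exists_ker_of_opAct_normPoly {a : ℕ → LaurentSeries ℚ}
    {δ : LaurentSeries ℚ →+ LaurentSeries ℚ} (hδ : IsConnection (F := LaurentSeries ℚ) δ)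
    {m : LaurentSeries ℚ} (hm : m ≠ 0) {k : ℕ} (ha : ∀ i < k, a i ≠ 0)
    (h : opAct δ (normPoly a k) m = 0) : ∃ f : LaurentSeries ℚ, f ≠ 0 ∧ δ f = 0 := by
  induction k with
  | zero => exact absurd (by rwa [normPoly, opAct_one] at h) hm
  | succ k ih =>
    rw [normPoly, opAct_C_mul, opAct_oreMul hδ, opAct_C_mul, smul_eq_zero,
      or_iff_right z_ne_zero] at h
    by_cases hx : opAct δ (normPoly a k) m = 0
    · exact ih (fun i hi => ha i (by omega)) hx
    · exact ⟨_, smul_ne_zero (ha k (by omega)) hx, h⟩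

theorem MonicOp.opAct_laurent_two (P : MonicOp RatFun 2) (w : LogSeries) :
    opAct (derivHom LogSeries) P.laurent w =
      w′′ + (ofRat (P.coeff 1) • w′ + ofRat (P.coeff 0) • w) := by
  rw [← P.eval_log, MonicOp.eval, MonicOp.act, Fin.sum_univ_two, algebraMap_smul, algebraMap_smul,
    add_comm (P.coeff 0 • _)]
  rfl

theorem MonicOp.laurent_eq_of_isSymPower {n : ℕ} {P : MonicOp RatFun 2}
    {S : MonicOp RatFun (n + 1)} (h : P.IsSymPower n S) :
    S.laurent = symPoly n (ofRat (P.coeff 1)) (ofRat (P.coeff 0)) (n + 1) := by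
  rw [MonicOp.laurent, MonicOp.isSymPower_iff.1 h, map_symPoly]

/-- If a twist of `L` is a symmetric power of an operator `P` of order two, then all structure
series of `L` are equal to the structure series of `P`. -/
theorem NormalForm.eq_of_isSymPower {n : ℕ} {L S : MonicOp RatFun (n + 1)} {y : ℕ → LogSeries}
    {a : ℕ → LaurentSeries ℚ} {α : ℕ → PowerSeries ℚ} (h : NormalForm L y a α) {g : AlgFun}
    (hg : g ≠ 0) (hLS : L.IsTensor g S) {P : MonicOp RatFun 2} (hP : P.IsSymPower n S)
    {x : ℕ → LogSeries} {b : ℕ → LaurentSeries ℚ} {β : ℕ → PowerSeries ℚ}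
    (hPx : NormalForm (n := 1) P x b β) : ∀ k, 1 ≤ k → k ≤ n → α k = β 1 := by
  obtain ⟨u, hu⟩ := hLS.exists_twist hg
  have hb0 : b 0 ≠ 0 := hPx.ne_zero 0 (by omega)
  set e := (b 0)⁻¹ with he
  have he0 : e ≠ 0 := inv_ne_zero hb0
  have hx0 : x 0 = Polynomial.C e := by
    have h1 : Polynomial.C (b 0) * x 0 = 1 := hPx.adapted 0 (by omega)
    apply mul_left_cancel₀ (Polynomial.C_ne_zero.2 hb0)
    rw [h1, he, ← Polynomial.C_mul, mul_inv_cancel₀ hb0, Polynomial.C_1]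
  set t := Polynomial.C (b 0) * x 1 with ht
  have hx1 : x 1 = Polynomial.C e * t := by
    rw [ht, ← mul_assoc, ← Polynomial.C_mul, he, inv_mul_cancel₀ hb0, Polynomial.C_1, one_mul]
  have htd : t.natDegree = 1 := by
    rw [ht, natDegree_C_mul_logSeries hb0, hPx.natDegree 1 le_rfl]
  have hth : Polynomial.C (ofPS (β 1)) * theta t = 1 := by
    rw [← hPx.eq_ofPS 1 le_rfl le_rfl]
    exact hPx.adapted 1 le_rfl
  have hSk : ∀ k ≤ n,
      opAct (derivHom LogSeries) S.laurent (Polynomial.C (e ^ n) * t ^ k) = 0 := by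
    intro k hk
    rw [MonicOp.laurent_eq_of_isSymPower hP, Polynomial.C_pow]
    have h0 := hPx.sol 0 (by omega)
    have h1 := hPx.sol 1 le_rfl
    rw [MonicOp.opAct_laurent_two, hx0] at h0
    rw [MonicOp.opAct_laurent_two, hx1] at h1
    refine opAct_symPoly_mul_pow ?_ ?_ hk
    · rw [eq_sub_iff_add_eq, eq_neg_iff_add_eq_zero, add_assoc, add_comm (ofRat (P.coeff 0) • _)]
      exact h0
    · rw [eq_sub_iff_add_eq, eq_neg_iff_add_eq_zero, add_assoc, add_comm (ofRat (P.coeff 0) • _)]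
      exact h1
  have hen : e ^ n ≠ 0 := pow_ne_zero n he0
  -- A horizontal section `f` of `∂ + u` in `ℚ((z))` comes from the solution `y 0` of `L`.
  obtain ⟨f, hf0, hf⟩ : ∃ f : LaurentSeries ℚ, f ≠ 0 ∧
      shift (derivHom (LaurentSeries ℚ)) (ofRat u) f = 0 := by
    obtain ⟨r, φ, hφ⟩ := h.exists_flag
    have hy0 := hφ.zero
    have hφ0 : z ^ r * ofPS (φ 0) ≠ 0 := mul_ne_zero (zpow_ne_zero _ z_ne_zero)
      (ofPS_ne_zero (ne_zero_of_constantCoeff (by rw [hφ.1]; exact one_ne_zero)))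
    have h1 := h.sol 0 (Nat.zero_le n)
    rw [hy0, opAct_log_C, Polynomial.C_eq_zero, opAct_laurent_of_twist hu,
      eq_C_mul_normPoly (fun k (_ : k ≤ n) => powFlag_adapted hen hth k) S.hasLead_laurent
      (fun k hk => opAct_powFlag_eq_zero (hSk k hk)), opAct_C_mul, smul_eq_zero] at h1
    have hpow : ∀ i < n + 1, powSeq (e ^ n)⁻¹ (ofPS (β 1)) i ≠ 0 := fun i hi =>
      ne_zero_of_adapted (fun k (_ : k ≤ n) => powFlag_adapted hen hth k) (Nat.le_of_lt_succ hi)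
    refine exists_ker_of_opAct_normPoly (isConnection_derivHom.shift _) hφ0 hpow
      (h1.resolve_left (inv_ne_zero (Finset.prod_ne_zero_iff.2 fun j hj =>
        mul_ne_zero z_ne_zero (hpow j (Finset.mem_range.1 hj)))))
  have hf' : f′ = -ofRat u * f := by
    rw [shift_apply, derivHom_apply, smul_eq_mul] at hf
    linear_combination hf
  refine h.eq_of_pow (mul_ne_zero hf0 hen) htd (hPx.constantCoeff 1 le_rfl le_rfl) hth
    fun k hk => ?_
  rw [opAct_laurent_of_twist hu, Polynomial.C_mul, mul_assoc, ← Polynomial.smul_eq_C_mul,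
    opAct_shift_of_smul (isConnection_derivHom.shift _) hf', shift_shift, add_neg_cancel,
    shift_zero, hSk k hk, smul_zero]

/-! ### Irreducibility of symmetric roots -/

theorem MonicOp.toPoly_two (P : MonicOp RatFun 2) : P.toPoly =
    Polynomial.X ^ 2 + (Polynomial.monomial 0 (P.coeff 0) + Polynomial.monomial 1 (P.coeff 1)) := by
  rw [MonicOp.toPoly, Fin.sum_univ_two]
  rfl

theorem hasLead_X_sub_C {F : Type} [Field F] (c : F) :
    HasLead (Polynomial.X - Polynomial.C c) 1 1 := by
  have := hasLead_X.add (hasLead_C (-c)).succ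
  rwa [add_zero, map_neg, ← sub_eq_add_neg] at this

/-- A right factor `∂ - v` of `P` yields the right factor `∂ - n v` of the `n`-th symmetric
power: both annihilate the powers of a formal solution `T` of `T' = v T`. -/
theorem exists_eq_opAct_X_sub_C {F : Type} [Field F] [Differential F] {a b v : F}
    (hv : v′ + v ^ 2 = -(a * v) - b) {n : ℕ} (hn : 1 ≤ n) :
    ∃ p : Polynomial F, symPoly n a b (n + 1) =
      opAct oreMul p (Polynomial.X - Polynomial.C (n * v)) := by
  set δ : Polynomial F →+ Polynomial F :=
    (Differential.implicitDeriv (Polynomial.C v * Polynomial.X)).toLinearMap.toAddMonoidHom with hδ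
  have hder : IsDerivationOver F δ := by
    refine ⟨fun x y => ?_, fun f => Differential.implicitDeriv_C ..⟩
    exact (Differential.implicitDeriv (Polynomial.C v * Polynomial.X)).leibniz x y
  have hT : δ Polynomial.X = v • Polynomial.X := by
    rw [Polynomial.smul_eq_C_mul]
    exact Differential.implicitDeriv_X ..
  have hTT : δ (δ Polynomial.X) = -(a • δ Polynomial.X) - b • Polynomial.X := by
    rw [hT, hder.isConnection, hT, smul_smul, smul_smul, ← add_smul, ← neg_smul, ← sub_smul,
      ← hv, sq]
  have hpow : δ (Polynomial.X ^ n) = ((n : F) * v) • Polynomial.X ^ n := by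
    obtain ⟨m, rfl⟩ := Nat.exists_eq_add_of_le' hn
    rw [hder.pow, hT, Polynomial.smul_eq_C_mul, Polynomial.smul_eq_C_mul, map_mul, map_natCast]
    ring
  -- Division with remainder by `∂ - n v`, as an expansion in `1` and the `∂^i (∂ - n v)`.
  set N : ℕ → Polynomial F := fun i =>
    if i = 0 then 1 else oreMul^[i - 1] (Polynomial.X - Polynomial.C (n * v)) with hN
  have hN0 : N 0 = 1 := if_pos rfl
  have hNs : ∀ i, N (i + 1) = oreMul^[i] (Polynomial.X - Polynomial.C (n * v)) :=
    fun i => if_neg i.succ_ne_zero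
  have hNlead : ∀ i, HasLead (N i) i 1 := by
    rintro (_ | i)
    · rw [hN0]; exact hasLead_one
    · rw [hNs, add_comm i]; exact (hasLead_X_sub_C _).iterate_oreMul i
  obtain ⟨r, hr⟩ := exists_eq_sum_of_hasLead (N := N) (l := fun _ => 1) (d := n + 2)
    (fun _ _ => one_ne_zero) (fun i _ => hNlead i) (p := symPoly n a b (n + 1))
    (Polynomial.degree_le_natDegree.trans_lt (by
      exact_mod_cast Nat.lt_succ_of_le (hasLead_symPoly n a b (n + 1)).1))
  have hNT : ∀ i, opAct δ (N (i + 1)) (Polynomial.X ^ n) = 0 := by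
    intro i
    rw [hNs, opAct_iterate_oreMul hder.isConnection, opAct_sub_left, opAct_X, opAct_C, hpow,
      sub_self]
    exact iterate_map_zero δ i
  have h0 := opAct_symPoly_eq_zero hder hTT n
  rw [hr, Finset.sum_range_succ', opAct_add_left, opAct_sum_left, Finset.sum_eq_zero, zero_add,
    opAct_C_mul, hN0, opAct_one, smul_eq_zero] at h0
  · have hr0 : r 0 = 0 := h0.resolve_right (pow_ne_zero _ Polynomial.X_ne_zero)
    refine ⟨∑ i ∈ Finset.range (n + 1), Polynomial.monomial i (r (i + 1)), ?_⟩
    rw [hr, Finset.sum_range_succ', hr0, map_zero, zero_mul, add_zero, opAct_sum_left]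
    refine Finset.sum_congr rfl fun i _ => ?_
    rw [opAct_monomial, hNs, Polynomial.smul_eq_C_mul]
  · intro i _
    rw [opAct_C_mul, hNT, smul_zero]

/-- An operator of order two is irreducible if a twist of one of its symmetric powers is. -/
theorem MonicOp.IsIrreducible.of_symPower {n : ℕ} (hn : 1 ≤ n) {L S : MonicOp RatFun (n + 1)}
    (hL : L.IsIrreducible) {u : RatFun} (hu : twist u S.toPoly = L.toPoly) {P : MonicOp RatFun 2}
    (hP : P.IsSymPower n S) : P.IsIrreducible := by
  refine ⟨by omega, fun k m A B hAB => ?_⟩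
  by_contra! hkm
  have hpoly : P.toPoly - opAct oreMul A.toPoly B.toPoly = 0 := by
    refine eq_zero_of_opAct_eq_zero deriv_ratFun_X fun y => ?_
    change opAct (derivHom RatFun) _ y = 0
    rw [opAct_sub_left, opAct_opAct_oreMul isConnection_derivHom, sub_eq_zero]
    have := hAB y
    rwa [P.eval_eq, A.eval_eq, B.eval_eq] at this
  have hlead := A.hasLead_toPoly.opAct_oreMul B.hasLead_toPoly
  rw [← sub_eq_zero.1 hpoly, mul_one] at hlead
  have hdeg := (hlead.natDegree_eq one_ne_zero).symm.trans
    (P.hasLead_toPoly.natDegree_eq one_ne_zero)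
  obtain ⟨rfl, rfl⟩ : k = 1 ∧ m = 1 := by omega
  set v := -B.coeff 0 with hv
  have hB : B.toPoly = Polynomial.X - Polynomial.C v := by
    rw [MonicOp.toPoly, pow_one, Fin.sum_univ_one, hv, map_neg, sub_neg_eq_add]
    rfl
  have hA : A.toPoly = Polynomial.X + Polynomial.C (A.coeff 0) := by
    rw [MonicOp.toPoly, pow_one, Fin.sum_univ_one]
    rfl
  -- The Riccati equation that says that `∂ - v` is a right factor of `P`.
  have hric : v′ + v ^ 2 = -(P.coeff 1 * v) - P.coeff 0 := by
    have h1 := sub_eq_zero.1 hpoly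
    rw [hA, hB, opAct_add_left, opAct_X, opAct_C, MonicOp.toPoly_two, map_sub, oreMul_apply,
      oreMul_apply, Differential.mapCoeffs_X, Differential.mapCoeffs_C,
      Polynomial.smul_eq_C_mul] at h1
    have c0 := congrArg (fun p => Polynomial.coeff p 0) h1
    have c1 := congrArg (fun p => Polynomial.coeff p 1) h1
    simp [Polynomial.coeff_C, Polynomial.coeff_monomial, Polynomial.coeff_X] at c0 c1
    rw [c0, c1]
    ring
  obtain ⟨p, hp⟩ := exists_eq_opAct_X_sub_C hric hn
  have hS := MonicOp.isSymPower_iff.1 hP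
  rw [hp] at hS
  have hpl : HasLead p n 1 := by
    have hS1 := S.hasLead_toPoly
    rw [hS] at hS1
    have h1 := (show HasLead p p.natDegree p.leadingCoeff from ⟨le_rfl, rfl⟩).opAct_oreMul
      (hasLead_X_sub_C (n * v))
    have hp0 : p ≠ 0 := by
      rintro rfl
      rw [opAct_zero_left] at hS1
      exact hS1.ne_zero one_ne_zero rfl
    rw [mul_one] at h1
    have h2 := (h1.natDegree_eq (Polynomial.leadingCoeff_ne_zero.2 hp0)).symm.trans
      (hS1.natDegree_eq one_ne_zero)
    have h3 : p.natDegree = n := by omega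
    refine ⟨h3.le, ?_⟩
    have h4 := h1.2.symm
    rw [h3, add_comm 1 n, hS1.2] at h4
    rw [← h4, Polynomial.leadingCoeff, h3]
  have := hL.2 n 1 (ofPoly n (twist u p))
    (ofPoly 1 (twist u (Polynomial.X - Polynomial.C (n * v)))) fun y => by
      rw [MonicOp.eval_eq, MonicOp.eval_eq, MonicOp.eval_eq, toPoly_ofPoly (hpl.twist u),
        toPoly_ofPoly ((hasLead_X_sub_C _).twist u), ← hu, hS]
      change opAct (derivHom RatFun) _ y =
        opAct (derivHom RatFun) _ (opAct (derivHom RatFun) _ y)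
      rw [opAct_twist isConnection_derivHom, opAct_twist isConnection_derivHom,
        opAct_twist isConnection_derivHom,
        opAct_opAct_oreMul ((isConnection_derivHom (F := RatFun) (A := RatFun)).shift u)]
  omega

/-! ### Operators of order two with Wronskian `1/z` -/

theorem MonicOp.eval_two (P : MonicOp RatFun 2) {A : Type} [CommRing A] [Differential A]
    [Algebra RatFun A] (w : A) : P.eval w = w′′ + (P.coeff 0 • w + P.coeff 1 • w′) := by
  rw [MonicOp.eval, MonicOp.act, Fin.sum_univ_two]
  rfl

/-- The operator `∂^2 + z⁻¹ ∂ + b`. -/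
def wronskianOp (b : RatFun) : MonicOp RatFun 2 := ⟨![b, RatFunc.X⁻¹]⟩

theorem wronskianOp_coeff_zero (b : RatFun) : (wronskianOp b).coeff 0 = b := rfl

theorem wronskianOp_coeff_one (b : RatFun) : (wronskianOp b).coeff 1 = RatFunc.X⁻¹ := rfl

/-- Property (P) for `∂^2 + z⁻¹ ∂ + b`. -/
theorem wronskianOp_dual (b y : RatFun) :
    (wronskianOp b).eval (RatFunc.X⁻¹ * y) = RatFunc.X⁻¹ * (wronskianOp b).dual y := by
  have hX : (RatFunc.X : RatFun) ≠ 0 := RatFunc.X_ne_zero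
  have hi : (RatFunc.X⁻¹ : RatFun)′ = -RatFunc.X⁻¹ ^ 2 := by
    rw [inv_eq_one_div, deriv_div_eq hX, deriv_one, deriv_ratFun_X]
    field_simp
    ring
  have hii : (RatFunc.X⁻¹ ^ 2 : RatFun)′ = -(2 * RatFunc.X⁻¹ ^ 3) := by
    rw [sq, deriv_mul, hi]
    ring
  have hdual : (wronskianOp b).dual y = y′′ + (b * y - (RatFunc.X⁻¹ * y)′) := by
    rw [MonicOp.dual, Fin.sum_univ_two]
    simp only [wronskianOp_coeff_zero, wronskianOp_coeff_one, Fin.val_zero, Fin.val_one,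
      Function.iterate_succ_apply', Function.iterate_zero, id_eq]
    ring
  rw [MonicOp.eval_two, hdual, wronskianOp_coeff_zero, wronskianOp_coeff_one, deriv_mul, hi,
    deriv_add, deriv_mul, deriv_mul, hi, map_neg, hii]
  simp only [smul_eq_mul]
  ring

theorem ofRat_X_inv : ofRat (RatFunc.X⁻¹) = z⁻¹ := by rw [map_inv₀, ofRat_X]

theorem deriv_sq {R : Type} [CommRing R] [Differential R] (x : R) : (x ^ 2)′ = 2 * x * x′ := by
  rw [sq, deriv_mul]
  ring

/-- If `h^2 t' = 1/z` and `h` is a solution of `∂^2 + z⁻¹ ∂ + b`, then so is `h t`. -/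
theorem deriv_deriv_C_mul_of_theta {η b : LaurentSeries ℚ} (hη : η ≠ 0)
    (hb : η′′ = -(z⁻¹ * η′) - b * η) {t : LogSeries} (ht : Polynomial.C (η ^ 2) * theta t = 1) :
    (Polynomial.C η * t)′′ = -(z⁻¹ • (Polynomial.C η * t)′) - b • (Polynomial.C η * t) := by
  have hne : z * η ^ 2 ≠ 0 := mul_ne_zero z_ne_zero (pow_ne_zero 2 hη)
  set τ := (z * η ^ 2)⁻¹ with hτ
  have hmul : z * η ^ 2 * τ = 1 := mul_inv_cancel₀ hne
  have htτ : t′ = Polynomial.C τ := by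
    apply mul_left_cancel₀ (Polynomial.C_ne_zero.2 hne)
    rw [← Polynomial.C_mul, hmul, Polynomial.C_1, ← ht, theta, ← mul_assoc, ← Polynomial.C_mul,
      mul_comm z]
  have hd := congrArg (fun x : LaurentSeries ℚ => x′) hmul
  simp only [deriv_mul, deriv_sq, deriv_z, deriv_one] at hd
  have key : 2 * η′ * τ + η * τ′ + z⁻¹ * η * τ = 0 := by
    apply mul_left_cancel₀ (mul_ne_zero z_ne_zero hη)
    rw [mul_zero, ← hd]
    field_simp [z_ne_zero]
    ring
  rw [deriv_mul, htτ, deriv_log_C, deriv_add, deriv_mul, deriv_mul, deriv_log_C, deriv_log_C,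
    deriv_log_C, htτ, hb, Polynomial.smul_eq_C_mul, Polynomial.smul_eq_C_mul]
  have key' := congrArg (Polynomial.C : LaurentSeries ℚ → LogSeries) key
  simp only [map_add, map_mul, map_zero, map_ofNat] at key'
  simp only [map_sub, map_neg, map_mul]
  linear_combination key'

/-- Data from which the operator `∂^2 + z⁻¹ ∂ + b` is of CY-type: a solution `h` with
`h^2 = β`, a solution `h t` with `β ϑ t = 1`, where `t = τ + log z` for a power series `τ`, and the
special coordinate `q`. -/
structure WronskianData (b : RatFun) (β h τ q : PowerSeries ℚ) : Prop where
  sq : h ^ 2 = β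
  constantCoeff : PowerSeries.constantCoeff h = 1
  sol : (ofPS h)′′ = -(z⁻¹ * (ofPS h)′) - ofRat b * ofPS h
  theta : Polynomial.C (ofPS β) * theta (Polynomial.C (ofPS τ) + Polynomial.X) = 1
  nIntegral_sol : NIntegral h
  nIntegral : NIntegral β
  coord : PowerSeries.X * q′ = β⁻¹ * q
  coord_zero : PowerSeries.constantCoeff q = 0
  coord_one : PowerSeries.coeff 1 q = 1
  nIntegral_coord : NIntegral q

namespace WronskianData

variable {b : RatFun} {β h τ q : PowerSeries ℚ}

theorem ne_zero (D : WronskianData b β h τ q) : ofPS h ≠ 0 :=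
  ofPS_ne_zero (ne_zero_of_constantCoeff (by rw [D.constantCoeff]; exact one_ne_zero))

theorem normalForm (D : WronskianData b β h τ q) : NormalForm (n := 1) (wronskianOp b)
    (fun k => Polynomial.C (ofPS h) * (Polynomial.C (ofPS τ) + Polynomial.X) ^ k)
    (powSeq (ofPS h)⁻¹ (ofPS β)) (fun _ => β) where
  exists_flag := by
    refine ⟨0, fun k => if k = 0 then h else h * τ, D.constantCoeff, fun k hk => ?_⟩
    obtain rfl | rfl : k = 0 ∨ k = 1 := by omega
    · simp
    · change Polynomial.C (ofPS h) * (Polynomial.C (ofPS τ) + Polynomial.X) ^ 1 = _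
      rw [Finset.sum_range_succ, Finset.sum_range_one, zpow_zero, one_mul, one_mul, pow_one,
        mul_add, ← Polynomial.C_mul_X_pow_eq_monomial, ← Polynomial.C_mul_X_pow_eq_monomial]
      simp
  sol k hk := by
    have h0 : ∀ w : LogSeries, w′′ = -(z⁻¹ • w′) - ofRat b • w →
        opAct (derivHom LogSeries) (wronskianOp b).laurent w = 0 := by
      intro w hw
      rw [MonicOp.opAct_laurent_two, hw, wronskianOp_coeff_zero, wronskianOp_coeff_one,
        ofRat_X_inv]
      abel
    obtain rfl | rfl : k = 0 ∨ k = 1 := by omega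
    · refine h0 _ ?_
      simp only [pow_zero, mul_one, deriv_log_C, Polynomial.smul_eq_C_mul, D.sol, map_sub, map_neg,
        map_mul]
    · refine h0 _ ?_
      rw [pow_one]
      refine deriv_deriv_C_mul_of_theta D.ne_zero D.sol ?_
      rw [← map_pow, D.sq]
      exact D.theta
  adapted k hk := by
    have := powFlag_adapted D.ne_zero D.theta k
    obtain rfl | rfl : k = 0 ∨ k = 1 := by omega
    · simpa [powFlag] using this
    · simpa [powFlag] using this
  eq_ofPS k hk _ := powSeq_pos _ _ hk

theorem isStructureSeries (D : WronskianData b β h τ q) :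
    MonicOp.IsStructureSeries (n := 1) (wronskianOp b) (fun _ => β) :=
  MonicOp.isStructureSeries_iff.2 ⟨_, _, D.normalForm⟩

theorem isIndicialPolynomial (D : WronskianData b β h τ q) :
    (wronskianOp b).IsIndicialPolynomial
      ((Polynomial.X - Polynomial.C ((0 : ℤ) : ℚ)) ^ (1 + 1)) := by
  have hh : PowerSeries.constantCoeff h ≠ 0 := by rw [D.constantCoeff]; exact one_ne_zero
  -- The coefficient `z^2 b` equals `-(ϑ^2 h) / h`, a power series without constant term.
  refine ⟨![-(PowerSeries.X * PowerSeries.derivative ℚ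
    (PowerSeries.X * PowerSeries.derivative ℚ h)) * h⁻¹, 1], ?_, ?_⟩
  · have hz := z_ne_zero
    intro i
    fin_cases i
    · change z ^ 2 * ofRat b = ofPS (-(PowerSeries.X * PowerSeries.derivative ℚ
        (PowerSeries.X * PowerSeries.derivative ℚ h)) * h⁻¹)
      apply mul_right_cancel₀ D.ne_zero
      rw [← map_mul, mul_assoc (-_) h⁻¹, PowerSeries.inv_mul_cancel _ hh, mul_one, map_neg, map_mul,
        ← deriv_ofPS, map_mul, ← deriv_ofPS, ← z, deriv_mul, deriv_z, D.sol]
      field_simp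
      ring
    · change z ^ 1 * ofRat RatFunc.X⁻¹ = ofPS 1
      rw [pow_one, ofRat_X_inv, mul_inv_cancel₀ z_ne_zero, map_one]
  · rw [Fin.sum_univ_two]
    simp [descPochhammer_succ_right]
    ring

theorem isCYType (D : WronskianData b β h τ q)
    (hirr : MonicOp.IsIrreducible (wronskianOp b)) :
    MonicOp.IsCYType (n := 1) (wronskianOp b) where
  irreducible := hirr
  propP := ⟨RatFunc.X⁻¹, inv_ne_zero RatFunc.X_ne_zero, wronskianOp_dual b⟩
  propM := ⟨0, D.isIndicialPolynomial⟩
  propN := by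
    refine ⟨h, ne_zero_of_constantCoeff (by rw [D.constantCoeff]; exact one_ne_zero),
      D.nIntegral_sol, ?_⟩
    rw [MonicOp.eval_two, D.sol, wronskianOp_coeff_zero, wronskianOp_coeff_one, Algebra.smul_def,
      Algebra.smul_def]
    change _ + (ofRat b * ofPS h + ofRat RatFunc.X⁻¹ * (ofPS h)′) = 0
    rw [ofRat_X_inv]
    ring
  propQ := ⟨q, ⟨le_rfl, _, D.isStructureSeries, D.coord, D.coord_zero, D.coord_one⟩,
    D.nIntegral_coord⟩
  propS := ⟨_, D.isStructureSeries, fun _ _ _ => D.nIntegral⟩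

end WronskianData

/-! ### Symmetric roots -/

theorem normalOp_congr {a b : ℕ → LaurentSeries ℚ} {k : ℕ} (h : ∀ i < k, a i = b i)
    (u : LogSeries) : normalOp a k u = normalOp b k u := by
  induction k with
  | zero => rfl
  | succ k ih => rw [normalOp, normalOp, ih fun i hi => h i (by omega), h k (by omega)]

/-- A logarithmic derivative from a square: if `c g^2 = B` for a constant `c`, then
`g' / g = B' / (2 B)`. -/
theorem deriv_eq_of_sq {F : Type} [Field F] [CharZero F] [Differential F] {c g B : F}
    (hc : c′ = 0) (hc0 : c ≠ 0) (hg0 : g ≠ 0) (hg : c * g ^ 2 = B) : g′ = B′ / (2 * B) * g := by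
  rw [← hg, deriv_mul, deriv_sq, hc]
  field_simp
  ring

theorem MonicOp.isTensor_ofPoly {d : ℕ} {L : MonicOp RatFun d} {g : AlgFun} (hg : g ≠ 0)
    {u : RatFun} (hgu : g′ = algebraMap RatFun AlgFun u * g) :
    L.IsTensor g (ofPoly d (twist (-u) L.toPoly)) := by
  intro y
  have hinv : (g⁻¹)′ = algebraMap RatFun AlgFun (-u) * g⁻¹ := by
    rw [inv_eq_one_div, deriv_div_eq hg, deriv_one, hgu, map_neg]
    field_simp
    ring
  rw [MonicOp.eval_eq, MonicOp.eval_eq, toPoly_ofPoly (L.hasLead_toPoly.twist _)]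
  change opAct (derivHom AlgFun) _ y = g * opAct (derivHom AlgFun) _ _
  have h := opAct_shift_of_smul (isConnection_derivHom (F := AlgFun)) hinv
    (L.toPoly.map (algebraMap RatFun AlgFun)) y
  have h5 : shift (derivHom AlgFun) (algebraMap RatFun AlgFun (-u)) =
      shift (derivHom AlgFun) (-u) := by
    ext m
    rw [shift_apply, shift_apply, algebraMap_smul]
  rw [opAct_map, opAct_map, h5, smul_eq_mul, smul_eq_mul] at h
  rw [opAct_twist isConnection_derivHom, h, mul_inv_cancel_left₀ hg]

/-- The function `t = y_1 / y_0` is the sum of the logarithm and a power series. -/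
theorem IsFlagOf.exists_eq_add_log {n : ℕ} {y : ℕ → LogSeries} {r : ℤ} {f : ℕ → PowerSeries ℚ}
    (hf : IsFlagOf n y r f) (hn : 1 ≤ n) {c : LaurentSeries ℚ}
    (hc : Polynomial.C c * y 0 = 1) :
    ∃ τ : PowerSeries ℚ, Polynomial.C c * y 1 = Polynomial.C (ofPS τ) + Polynomial.X := by
  have hf0 : PowerSeries.constantCoeff (f 0) ≠ 0 := by rw [hf.1]; exact one_ne_zero
  have h0 : c * (z ^ r * ofPS (f 0)) = 1 := by
    rw [hf.zero, ← Polynomial.C_mul, ← Polynomial.C_1] at hc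
    exact Polynomial.C_injective hc
  refine ⟨f 1 * (f 0)⁻¹, ?_⟩
  have h1 : c * (z ^ r * ofPS (f 1)) = ofPS (f 1 * (f 0)⁻¹) := by
    apply mul_right_cancel₀ (ofPS_ne_zero (ne_zero_of_constantCoeff hf0))
    rw [← map_mul, mul_assoc (f 1), PowerSeries.inv_mul_cancel _ hf0, mul_one]
    linear_combination ofPS (f 1) * h0
  rw [hf.2 1 hn, Finset.sum_range_succ, Finset.sum_range_one, mul_add, Polynomial.C_mul_monomial,
    Polynomial.C_mul_monomial, ← Polynomial.C_mul_X_pow_eq_monomial,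
    ← Polynomial.C_mul_X_pow_eq_monomial]
  have h2 : PowerSeries.C (1 / ((1 : ℕ) : ℚ)) = 1 := by simp
  rw [Nat.factorial_zero, Nat.factorial_one, h2, one_mul, one_mul, h1, h0, pow_zero, pow_one,
    mul_one, map_one, one_mul]

/-- If all structure series of an operator `L` of CY-type agree, then a twist of `L` is a symmetric
power of an operator of CY-type of order two. -/
theorem NormalForm.exists_isSymPower {n : ℕ} {L : MonicOp RatFun (n + 1)} {y : ℕ → LogSeries}
    {a : ℕ → LaurentSeries ℚ} {α : ℕ → PowerSeries ℚ} (h : NormalForm L y a α) (hn : 1 ≤ n)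
    (hL : L.IsCYType) (hα : ∀ k, 1 ≤ k → k ≤ n → α k = α 1) :
    ∃ g : AlgFun, g ≠ 0 ∧ ∃ S : MonicOp RatFun (n + 1), L.IsTensor g S ∧
      ∃ P : MonicOp RatFun 2, P.IsCYType ∧ P.IsSymPower n S := by
  have hstr := MonicOp.isStructureSeries_iff.2 ⟨y, a, h⟩
  obtain ⟨A, hA0, hA⟩ := hL.propP
  obtain ⟨⟨κ, hκ, hκA⟩, -⟩ := h.duality hA0 hA
  set β := α 1 with hβ
  have hβ1 : PowerSeries.constantCoeff β = 1 := h.constantCoeff 1 le_rfl hn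
  have hβN : NIntegral β := by
    obtain ⟨α', hα', hN⟩ := hL.propS
    rw [hβ, ← hstr.unique hα' 1 le_rfl hn]
    exact hN 1 le_rfl hn
  obtain ⟨s, hsβ, hs1, hsN⟩ := hβN.exists_sq_eq hβ1
  set η := ofPS s with hη
  have hηβ : η ^ 2 = ofPS β := by rw [hη, ← map_pow, hsβ]
  have hη0 : η ≠ 0 := ofPS_ne_zero (ne_zero_of_constantCoeff (by rw [hs1]; exact one_ne_zero))
  have ha0 : a 0 ≠ 0 := h.ne_zero 0 (Nat.zero_le n)
  have haβ : ∀ i < n + 1, a i = powSeq (a 0)⁻¹⁻¹ (ofPS β) i := by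
    intro i hi
    rcases i with _ | i
    · rw [powSeq_zero, inv_inv]
    · rw [powSeq_pos _ _ (Nat.succ_pos i), h.eq_ofPS _ (Nat.succ_pos i) (by omega),
        hα _ (Nat.succ_pos i) (by omega)]
  -- The function `t` and the solutions `y_0 t^k` of `L`.
  set t := Polynomial.C (a 0) * y 1 with ht
  have hθ : Polynomial.C (ofPS β) * theta t = 1 := by
    rw [hβ, ← h.eq_ofPS 1 le_rfl hn]
    exact h.adapted 1 hn
  have hLk : ∀ k ≤ n, opAct (derivHom LogSeries) L.laurent (powFlag (a 0)⁻¹ t k) = 0 := by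
    intro k hk
    rw [h.opAct_eq_zero_iff, normalOp_congr haβ]
    exact normalOp_eq_zero_of_lt (Nat.lt_succ_of_le hk) (powFlag_adapted (inv_ne_zero ha0) hθ k)
  -- The twist by `g = B^(1/2)`, whose expansion at zero is a multiple of `G = h^n / y_0`.
  set B : RatFun := (A * RatFunc.X ^ n)⁻¹ with hB
  have hB0 : B ≠ 0 := inv_ne_zero (mul_ne_zero hA0 (pow_ne_zero _ RatFunc.X_ne_zero))
  set G := a 0 * η ^ n with hG
  have hG0 : G ≠ 0 := mul_ne_zero ha0 (pow_ne_zero n hη0)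
  have hGB : cst κ * G ^ 2 = ofRat B := by
    have hprod : ∏ i ∈ Finset.range (n + 1), (z * a i) = z ^ (n + 1) * a 0 * (η ^ n) ^ 2 := by
      rw [Finset.prod_range_succ', Finset.prod_congr rfl (g := fun _ => z * ofPS β)]
      · rw [Finset.prod_const, Finset.card_range, ← hηβ]
        ring
      · intro i hi
        rw [Finset.mem_range] at hi
        rw [haβ (i + 1) (by omega), powSeq_pos _ _ (Nat.succ_pos i)]
    rw [hprod] at hκA
    rw [hG, mul_pow, sq (a 0), mul_assoc (a 0), ← mul_assoc, ← hκA, hB, map_inv₀, map_mul, map_pow,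
      ofRat_X]
    have hz := z_ne_zero
    have hA' : ofRat A ≠ 0 := (map_ne_zero ofRat).2 hA0
    field_simp
    ring
  set u : RatFun := B′ / (2 * B) with hu
  have hGu : G′ = ofRat u * G := by
    rw [deriv_eq_of_sq (deriv_cst κ) ((map_ne_zero cst).2 hκ) hG0 hGB, hu, map_div₀, map_mul,
      DifferentialAlgebra.deriv_algebraMap, map_ofNat]
  obtain ⟨g, hg⟩ := IsAlgClosed.exists_pow_nat_eq (algebraMap RatFun AlgFun B) two_pos
  have hg0 : g ≠ 0 := by
    rintro rfl
    rw [zero_pow two_ne_zero, eq_comm] at hg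
    exact hB0 ((map_eq_zero _).1 hg)
  have hgu : g′ = algebraMap RatFun AlgFun u * g := by
    rw [deriv_eq_of_sq deriv_one one_ne_zero hg0 ((one_mul _).trans hg), hu, map_div₀, map_mul,
      DifferentialAlgebra.deriv_algebraMap, map_ofNat]
  have hS := MonicOp.isTensor_ofPoly (L := L) hg0 hgu
  refine ⟨g, hg0, _, hS, ?_⟩
  set S := ofPoly (n + 1) (twist (-u) L.toPoly) with hSdef
  have hSL : twist (-u) L.toPoly = S.toPoly := (toPoly_ofPoly (L.hasLead_toPoly.twist _)).symm
  have hSk : ∀ k ≤ n, opAct (derivHom LogSeries) S.laurent (powFlag (η ^ n) t k) = 0 := by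
    intro k hk
    have h1 : powFlag (η ^ n) t k = G • powFlag (a 0)⁻¹ t k := by
      rw [powFlag, powFlag, Polynomial.smul_eq_C_mul, ← mul_assoc (Polynomial.C G),
        ← Polynomial.C_mul, hG, mul_right_comm, mul_inv_cancel₀ ha0, one_mul]
    rw [h1, opAct_laurent_of_twist hSL, opAct_shift_of_smul (isConnection_derivHom.shift _) hGu,
      shift_shift, ← map_add, neg_add_cancel, map_zero, shift_zero, hLk k hk, smul_zero]
  -- The operator of order two with solutions `h` and `h t`, first over `ℚ((z))`.
  set b := -(η′′ + z⁻¹ * η′) / η with hb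
  have hbη : η′′ = -(z⁻¹ * η′) - b * η := by
    rw [hb, div_mul_cancel₀ _ hη0]
    ring
  have hSsym : S.laurent = symPoly n z⁻¹ b (n + 1) := by
    rw [← sub_eq_zero]
    refine eq_zero_of_opAct_adapted (n := n)
      (fun k _ => powFlag_adapted (pow_ne_zero n hη0) hθ k)
      (S.hasLead_laurent.natDegree_sub_lt (hasLead_symPoly n _ _ (n + 1))) fun k hk => ?_
    rw [opAct_sub_left, hSk k hk, zero_sub, neg_eq_zero]
    refine opAct_powFlag_eq_zero ?_
    rw [Polynomial.C_pow]
    refine opAct_symPoly_mul_pow ?_ ?_ hk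
    · simp only [deriv_log_C, Polynomial.smul_eq_C_mul, hbη, map_sub, map_neg, map_mul]
    · exact deriv_deriv_C_mul_of_theta hη0 hbη (by rw [hηβ]; exact hθ)
  -- The coefficient of `∂^(n-1)` in `S` shows that `b` is rational.
  obtain ⟨b₀, hb₀⟩ : ∃ b₀ : RatFun, ofRat b₀ = b := by
    obtain ⟨r, m, hm, hr⟩ := (coeff_symPoly (F₀ := RatFun) n RatFunc.X⁻¹ b (n - 1)).2 (by omega)
    refine ⟨(S.toPoly.coeff (n - 1) - r) / m, ?_⟩
    change (symPoly n (ofRat RatFunc.X⁻¹) b (n - 1 + 2)).coeff (n - 1) = ofRat r + m * b at hr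
    rw [ofRat_X_inv, show n - 1 + 2 = n + 1 by omega, ← hSsym, MonicOp.laurent,
      Polynomial.coeff_map] at hr
    rw [map_div₀, map_sub, hr, map_natCast, add_sub_cancel_left,
      mul_div_cancel_left₀ _ (Nat.cast_ne_zero.2 hm.ne')]
  have hsym : (wronskianOp b₀).IsSymPower n S := by
    rw [MonicOp.isSymPower_iff]
    apply Polynomial.map_injective ofRat (RingHom.injective _)
    rw [map_symPoly, wronskianOp_coeff_zero, wronskianOp_coeff_one]
    change _ = symPoly n (ofRat RatFunc.X⁻¹) (ofRat b₀) (n + 1)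
    rw [ofRat_X_inv, hb₀, ← hSsym]
    rfl
  refine ⟨wronskianOp b₀, ?_, hsym⟩
  obtain ⟨r, f, hf⟩ := h.exists_flag
  obtain ⟨τ, hτ⟩ := hf.exists_eq_add_log hn (h.adapted 0 (Nat.zero_le n))
  obtain ⟨q, ⟨-, α', hα', hq, hq0, hq1⟩, hqN⟩ := hL.propQ
  obtain ⟨v, hv⟩ := hS.exists_twist hg0
  have D : WronskianData b₀ β s τ q :=
    { sq := hsβ
      constantCoeff := hs1
      sol := by rw [hb₀]; exact hbη
      theta := by rw [← hτ]; exact hθ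
      nIntegral_sol := hsN
      nIntegral := hβN
      coord := by rw [hq, hstr.unique hα' 1 le_rfl hn]
      coord_zero := hq0
      coord_one := hq1
      nIntegral_coord := hqN }
  exact D.isCYType (hL.irreducible.of_symPower hn hv hsym)

/-! ### The `Y`-invariants -/

theorem MonicOp.IsYInvariant.eq_one {n : ℕ} {L : MonicOp RatFun (n + 1)} {α : ℕ → PowerSeries ℚ}
    (hα : L.IsStructureSeries α) (h1 : ∀ k, 1 ≤ k → k ≤ n → α k = α 1) {i : ℕ} (hi : 1 ≤ i)
    (hin : i + 2 ≤ n) {Y : PowerSeries ℚ} (hY : L.IsYInvariant i Y) : Y = 1 := by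
  obtain ⟨α', q, p, hα', -, hp, -, rfl⟩ := hY
  obtain ⟨y, a, h⟩ := MonicOp.isStructureSeries_iff.1 hα'
  have hinv : (1 : PowerSeries ℚ)⁻¹ = 1 := by
    rw [PowerSeries.inv_eq_iff_mul_eq_one (by simp), mul_one]
  rw [hα.unique hα' (i + 1) (by omega) (by omega), hα.unique hα' 1 le_rfl (by omega),
    h1 (i + 1) (by omega) (by omega), ← hα.unique hα' 1 le_rfl (by omega),
    PowerSeries.mul_inv_cancel _ (by rw [h.constantCoeff 1 le_rfl (by omega)]; exact one_ne_zero),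
    hinv, subst_one hp]

theorem MonicOp.exists_isYInvariant {n : ℕ} {L : MonicOp RatFun (n + 1)} (hL : L.IsCYType)
    {α : ℕ → PowerSeries ℚ} (hα : L.IsStructureSeries α) (i : ℕ) :
    ∃ Y : PowerSeries ℚ, L.IsYInvariant i Y ∧ (Y = 1 → (α (i + 1) * (α 1)⁻¹)⁻¹ = 1) := by
  obtain ⟨q, hq, -⟩ := hL.propQ
  obtain ⟨-, α', hα', -, hq0, hq1⟩ := id hq
  obtain ⟨p, hp, hpq, hqp⟩ := exists_subst_eq_X hq0 hq1
  exact ⟨_, ⟨α, q, p, hα, hq, hp, hpq, rfl⟩, fun h => eq_one_of_subst_eq_one hp hq0 hqp h⟩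

end CYOp

end

theorem mainTheorem4 (n : ℕ) (L : CYOp.MonicOp (RatFunc ℚ) (n + 1)) (hL : L.IsCYType) :
    (∃ g : AlgebraicClosure (RatFunc ℚ), g ≠ 0 ∧
      ∃ S : CYOp.MonicOp (RatFunc ℚ) (n + 1), L.IsTensor g S ∧
        ∃ P : CYOp.MonicOp (RatFunc ℚ) 2, P.IsCYType ∧ P.IsSymPower n S) ↔
      ∀ i : ℕ, 1 ≤ i → i + 2 ≤ n → ∀ Y : PowerSeries ℚ, L.IsYInvariant i Y ↔ Y = 1 := by
  obtain ⟨α, hα, -⟩ := hL.propS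
  obtain ⟨y, a, h⟩ := CYOp.MonicOp.isStructureSeries_iff.1 hα
  constructor
  · rintro ⟨g, hg, S, hS, P, hP, hPS⟩ i hi hin Y
    obtain ⟨β, hβ, -⟩ := hP.propS
    obtain ⟨x, b, hx⟩ := (CYOp.MonicOp.isStructureSeries_iff (n := 1)).1 hβ
    have key := h.eq_of_isSymPower hg hS hPS hx
    have h1 : ∀ k, 1 ≤ k → k ≤ n → α k = α 1 := fun k hk hkn =>
      (key k hk hkn).trans (key 1 le_rfl (by omega)).symm
    refine ⟨fun hY => hY.eq_one hα h1 hi hin, ?_⟩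
    rintro rfl
    obtain ⟨Y, hY, -⟩ := CYOp.MonicOp.exists_isYInvariant hL hα i
    rwa [hY.eq_one hα h1 hi hin] at hY
  · intro hY
    have hn : 1 ≤ n := by
      obtain ⟨q, ⟨hn, -⟩, -⟩ := hL.propQ
      exact hn
    refine h.exists_isSymPower hn hL ?_
    have h1 : ∀ k, 1 ≤ k → k + 1 ≤ n → α k = α 1 := by
      intro k hk hkn
      obtain rfl | hk' := hk.eq_or_lt
      · rfl
      obtain ⟨Y, hYi, hY1⟩ := CYOp.MonicOp.exists_isYInvariant hL hα (k - 1)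
      have h2 := hY1 ((hY (k - 1) (by omega) (by omega) Y).1 hYi)
      have hc1 := h.constantCoeff 1 le_rfl hn
      have hck := h.constantCoeff k hk (by omega)
      rw [Nat.sub_add_cancel hk, PowerSeries.inv_eq_iff_mul_eq_one (by simp [hc1, hck]),
        one_mul] at h2
      calc α k = α k * (α 1)⁻¹ * α 1 := by
            rw [mul_assoc, PowerSeries.inv_mul_cancel _ (by rw [hc1]; exact one_ne_zero), mul_one]
        _ = α 1 := by rw [h2, one_mul]
    intro k hk hkn
    obtain rfl | hk' := hkn.eq_or_lt
    · -- The last structure series equals the first one by duality.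
      obtain ⟨A, hA0, hA⟩ := hL.propP
      have := (h.duality hA0 hA).2 1 le_rfl hn
      rwa [Nat.add_sub_cancel] at this
    · exact h1 k hk hk'
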